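/- **Setting.** There are $K$ arms, a measurable context space $\mathcal X$, a horizon $T\ge 1$ and $M\ge 1$ base algorithms $\mathcal B_1,\dots,\mathcal B_M$; $\mathcal B_m$ competes with a finite nonempty class $\Pi_m$ of measurable policies $\pi:\mathcal X\to[K]$. In round $t$ an adaptive adversary draws a context $x_t$ and a loss vector $\ell_t\in[0,1]^K$ from a joint distribution that may depend on everything that happened in rounds $1,\dots,t-1$. Independently of $(x_t,\ell_t)$ given the past, the top algorithm draws $M_t\sim q_t$; the selected base algorithm $\mathcal B_{M_t}$ draws an arm $A_t$, given $x_t$ and its own past observations, and is fed the importance-weighted loss $\ell_{t,A_t}/q_{t,M_t}$. (A base algorithm observes the context of every round, and its arm and fed loss in the rounds in which it was selected.) **Hedged Tsallis-INF.** Fix $\eta>0$, $R\in[0,\infty)^M$, $\beta\in(0,1/M]^M$. Let $F(q)=-2\sum_i\sqrt{q_i}$ on the simplex $\Delta^{M-1}$, and let $$q_{t}=\arg\min_{q\in\Delta^{M-1}}\Big\langle q,\sum_{s<t}(\hat\ell_s-b_s)\Big\rangle+\frac1\eta F(q),\qquad \hat\ell_s=\frac{\ell_{s,A_s}}{q_{s,M_s}}\mathbf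 e_{M_s},$$ so that $q_1$ is uniform. Put $\rho_{t,m}^{-1}=\min\{\beta_m,\min_{s\le t}q_{s,m}\}$ and $B_{0,m}=\sqrt{\rho_{1,m}}R_m$. The bias $b_t$ is the nonnegative multiple of $\mathbf e_{M_t}$ for which $B_{0,m}+\sum_{s\le t}b_{s,m}=\sqrt{\rho_{t+1,m}}\,R_m$ holds for $m=M_t$ (it exists, is unique, and the identity then holds for all $m$). **Regret.** Let $$\mathrm{Reg}(T,\mathcal B_m)=\max_{\pi\in\Pi_m}\mathbb E\Big[\sum_{t=1}^T\ell_{t,A_t}-\ell_{t,\pi(x_t)}\Big],\qquad \mathrm{Reg}_{\mathrm{Imp}}(T,\mathcal B_m)=\max_{\pi\in\Pi_m}\mathbb E\Big[\sum_{t=1}^T\frac{\mathbb 1(M_t=m)}{q_{t,m}}\big(\ell_{t,A_t}-\ell_{t,\pi(x_t)}\big)\Big].$$ **Theorem.** Let $\mathfrak C>0$ and $\mathfrak C_1,\dots,\mathfrak C_M>0$, and run hedged Tsallis-INF with $$\eta=\sqrt{2/T},\qquad R_m=\sqrt{\mathfrak C_mT},\qquad \beta_m=\frac1M\min\Big\{1,\frac{\mathfrak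 C^2}{\mathfrak C_m}\Big\}.$$ If the base algorithms are $(1/2,\sqrt{\mathfrak C_mT})$-stable, that is, $$\forall m\in[M]:\quad \mathrm{Reg}_{\mathrm{Imp}}(T,\mathcal B_m)\le\mathbb E\big[\sqrt{\rho_{T,m}}\big]\sqrt{\mathfrak C_mT},$$ then $$\forall m\in[M]:\quad \mathrm{Reg}(T,\mathcal B_m)\le 2\max\Big\{\mathfrak C,\frac{\mathfrak C_m}{\mathfrak C}\Big\}\sqrt{MT}+2\sqrt{2MT}.$$ -/

import Mathlib

open MeasureTheory ProbabilityTheory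

noncomputable section

namespace HedgedTsallis

/-! ### The FTRL rule with the `1/2`-Tsallis potential -/

/-- The potential `F(q) = -2 ∑ i, √(q i)`. -/
def tsallisPotential {M : ℕ} (q : Fin M → ℝ) : ℝ := -2 * ∑ i, √(q i)

/-- The FTRL objective `⟨q, z⟩ + F(q) / η`. -/
def ftrlObjective {M : ℕ} (η : ℝ) (z q : Fin M → ℝ) : ℝ :=
  (∑ i, q i * z i) + tsallisPotential q / η

theorem continuous_ftrlObjective {M : ℕ} (η : ℝ) :
    Continuous (fun p : (Fin M → ℝ) × (Fin M → ℝ) => ftrlObjective η p.1 p.2) := by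
  unfold ftrlObjective tsallisPotential
  fun_prop

theorem exists_ftrl {M : ℕ} [NeZero M] (η : ℝ) (z : Fin M → ℝ) :
    ∃ q ∈ stdSimplex ℝ (Fin M), IsMinOn (ftrlObjective η z) (stdSimplex ℝ (Fin M)) q := by
  refine (isCompact_stdSimplex ℝ (Fin M)).exists_isMinOn ⟨_, single_mem_stdSimplex ℝ 0⟩ ?_
  exact ((continuous_ftrlObjective η).comp (by fun_prop : Continuous fun q => (z, q))).continuousOn

/-- The FTRL distribution `argmin_{q ∈ Δ} ⟨q, z⟩ + F(q) / η` (unique for `η > 0`, see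
`ftrl_unique`). -/
def ftrl {M : ℕ} [NeZero M] (η : ℝ) (z : Fin M → ℝ) : Fin M → ℝ :=
  Classical.choose (exists_ftrl η z)

theorem ftrl_mem {M : ℕ} [NeZero M] (η : ℝ) (z : Fin M → ℝ) :
    ftrl η z ∈ stdSimplex ℝ (Fin M) := (Classical.choose_spec (exists_ftrl η z)).1

theorem ftrl_isMinOn {M : ℕ} [NeZero M] (η : ℝ) (z : Fin M → ℝ) :
    IsMinOn (ftrlObjective η z) (stdSimplex ℝ (Fin M)) (ftrl η z) :=
  (Classical.choose_spec (exists_ftrl η z)).2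

theorem ftrl_unique {M : ℕ} [NeZero M] {η : ℝ} (hη : 0 < η) (z q : Fin M → ℝ)
    (hq : q ∈ stdSimplex ℝ (Fin M))
    (hmin : IsMinOn (ftrlObjective η z) (stdSimplex ℝ (Fin M)) q) : ftrl η z = q := by
  set p := ftrl η z with hp
  have hpm : p ∈ stdSimplex ℝ (Fin M) := ftrl_mem η z
  have hpmin := ftrl_isMinOn η z
  by_contra hne
  obtain ⟨j, hj⟩ : ∃ j, p j ≠ q j := by
    by_contra h
    push Not at h
    exact hne (funext h)
  set r : Fin M → ℝ := fun i => (1 / 2) * p i + (1 / 2) * q i with hr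
  have hrm : r ∈ stdSimplex ℝ (Fin M) := by
    refine ⟨fun i => ?_, ?_⟩
    · have := hpm.1 i
      have := hq.1 i
      simp only [hr]
      linarith
    · simp only [hr, Finset.sum_add_distrib, ← Finset.mul_sum, hpm.2, hq.2]
      norm_num
  have h1 : ftrlObjective η z p ≤ ftrlObjective η z r := hpmin hrm
  have h2 : ftrlObjective η z q ≤ ftrlObjective η z r := hmin hrm
  have hlt : ∑ i, ((1 / 2) * √(p i) + (1 / 2) * √(q i)) < ∑ i, √(r i) := by
    refine Finset.sum_lt_sum (fun i _ => ?_) ⟨j, Finset.mem_univ j, ?_⟩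
    · simpa [hr] using Real.strictConcaveOn_sqrt.concaveOn.2 (hpm.1 i) (hq.1 i)
        (by norm_num : (0 : ℝ) ≤ 1 / 2) (by norm_num : (0 : ℝ) ≤ 1 / 2) (by norm_num)
    · simpa [hr] using Real.strictConcaveOn_sqrt.2 (hpm.1 j) (hq.1 j) hj
        (by norm_num : (0 : ℝ) < 1 / 2) (by norm_num : (0 : ℝ) < 1 / 2) (by norm_num)
  have hlin : ∑ i, r i * z i = (1 / 2) * ∑ i, p i * z i + (1 / 2) * ∑ i, q i * z i := by
    rw [Finset.mul_sum, Finset.mul_sum, ← Finset.sum_add_distrib]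
    exact Finset.sum_congr rfl fun i _ => by simp only [hr]; ring
  rw [Finset.sum_add_distrib, ← Finset.mul_sum, ← Finset.mul_sum] at hlt
  have h3 : tsallisPotential r / η <
      (1 / 2) * (tsallisPotential p / η) + (1 / 2) * (tsallisPotential q / η) := by
    have : tsallisPotential r <
        (1 / 2) * tsallisPotential p + (1 / 2) * tsallisPotential q := by
      unfold tsallisPotential
      linarith
    have h4 := div_lt_div_of_pos_right this hη
    calc _ < _ := h4
      _ = _ := by ring
  unfold ftrlObjective at h1 h2
  linarith

theorem continuous_ftrl {M : ℕ} [NeZero M] {η : ℝ} (hη : 0 < η) :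
    Continuous (ftrl η : (Fin M → ℝ) → Fin M → ℝ) := by
  have : CompactSpace (stdSimplex ℝ (Fin M)) :=
    isCompact_iff_compactSpace.1 (isCompact_stdSimplex ℝ (Fin M))
  set f : (Fin M → ℝ) → stdSimplex ℝ (Fin M) := fun z => ⟨ftrl η z, ftrl_mem η z⟩ with hf
  suffices h : Continuous f from continuous_subtype_val.comp h
  have hG : IsClosed {p : (Fin M → ℝ) × stdSimplex ℝ (Fin M) |
      ∀ r ∈ stdSimplex ℝ (Fin M), ftrlObjective η p.1 p.2 ≤ ftrlObjective η p.1 r} := by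
    simp only [Set.ofPred_forall]
    refine isClosed_iInter fun r => isClosed_iInter fun _ => isClosed_le ?_ ?_
    · exact (continuous_ftrlObjective η).comp
        (by fun_prop : Continuous fun p : (Fin M → ℝ) × stdSimplex ℝ (Fin M) =>
          (p.1, (p.2 : Fin M → ℝ)))
    · exact (continuous_ftrlObjective η).comp
        (by fun_prop : Continuous fun p : (Fin M → ℝ) × stdSimplex ℝ (Fin M) => (p.1, r))
  rw [continuous_iff_isClosed]
  intro C hC
  have := isClosedMap_fst_of_compactSpace (X := Fin M → ℝ) (Y := stdSimplex ℝ (Fin M)) _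
    (hG.inter (hC.preimage continuous_snd))
  convert this using 1
  ext z
  simp only [Set.mem_preimage, Set.mem_image, Set.mem_inter_iff, Prod.exists, exists_and_right,
    exists_eq_right]
  constructor
  · exact fun h => ⟨f z, fun r hr => ftrl_isMinOn η z hr, h⟩
  · rintro ⟨q, h1, h2⟩
    have : f z = q := Subtype.ext (ftrl_unique hη z q q.2 fun r hr => h1 r hr)
    rwa [this]

theorem ftrl_pos {M : ℕ} [NeZero M] {η : ℝ} (hη : 0 < η) (z : Fin M → ℝ) (i : Fin M) :
    0 < ftrl η z i := by
  set q := ftrl η z with hq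
  have hqm : q ∈ stdSimplex ℝ (Fin M) := ftrl_mem η z
  by_contra hneg
  have hi : q i = 0 := le_antisymm (not_lt.1 hneg) (hqm.1 i)
  obtain ⟨j, hj⟩ : ∃ j, 0 < q j := by
    by_contra h
    push Not at h
    have := Finset.sum_nonpos (s := Finset.univ) fun k _ => h k
    rw [hqm.2] at this
    linarith
  have hij : i ≠ j := by
    rintro rfl
    linarith
  -- moving the mass `x ^ 2` from `j` to `i` lowers the objective for small `x`
  have key : ∀ x : ℝ, 0 < x → x ^ 2 ≤ q j →
      2 * x ≤ x ^ 2 * (η * (z i - z j) + 2 / √(q j)) := by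
    intro x hx hxj
    set p : Fin M → ℝ := q + Pi.single i (x ^ 2) - Pi.single j (x ^ 2) with hp
    have hpi : p i = x ^ 2 := by simp [hp, hi, hij]
    have hpj : p j = q j - x ^ 2 := by simp [hp, hij.symm]
    have hpk : ∀ k, k ≠ i → k ≠ j → p k = q k := fun k h1 h2 => by simp [hp, h1, h2]
    have hpm : p ∈ stdSimplex ℝ (Fin M) := by
      refine ⟨fun k => ?_, ?_⟩
      · by_cases h1 : k = i
        · rw [h1, hpi]; positivity
        by_cases h2 : k = j
        · rw [h2, hpj]; linarith
        rw [hpk k h1 h2]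
        exact hqm.1 k
      · simp [hp, Finset.sum_add_distrib, Finset.sum_sub_distrib, hqm.2]
    have hmin : ftrlObjective η z q ≤ ftrlObjective η z p := ftrl_isMinOn η z hpm
    have hlin : ∑ k, p k * z k = ∑ k, q k * z k + x ^ 2 * (z i - z j) := by
      simp only [hp, Pi.add_apply, Pi.sub_apply, add_mul, sub_mul, Finset.sum_add_distrib,
        Finset.sum_sub_distrib, Pi.single_apply, ite_mul, zero_mul, Finset.sum_ite_eq',
        Finset.mem_univ, if_true]
      ring
    have hsq : ∑ k, √(p k) - ∑ k, √(q k) = x + (√(q j - x ^ 2) - √(q j)) := by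
      rw [← Finset.sum_sub_distrib, ← Finset.sum_subset (Finset.subset_univ {i, j}),
        Finset.sum_pair hij, hpi, hpj, hi, Real.sqrt_sq hx.le, Real.sqrt_zero, sub_zero]
      intro k _ hk
      simp only [Finset.mem_insert, Finset.mem_singleton, not_or] at hk
      rw [hpk k hk.1 hk.2, sub_self]
    have hdiff : √(q j) - √(q j - x ^ 2) ≤ x ^ 2 / √(q j) := by
      rw [le_div_iff₀ (Real.sqrt_pos.2 hj)]
      have h1 := Real.sq_sqrt hj.le
      have h2 := Real.sq_sqrt (sub_nonneg.2 hxj)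
      have h3 : √(q j - x ^ 2) ≤ √(q j) := Real.sqrt_le_sqrt (by nlinarith)
      have h4 := Real.sqrt_nonneg (q j - x ^ 2)
      nlinarith
    unfold ftrlObjective tsallisPotential at hmin
    rw [hlin] at hmin
    have h5 : 0 ≤ x ^ 2 * (z i - z j) + (-2 * ∑ k, √(p k) - -2 * ∑ k, √(q k)) / η := by
      rw [sub_div]
      linarith
    have h6 : 0 ≤ η * (x ^ 2 * (z i - z j)) - 2 * (∑ k, √(p k) - ∑ k, √(q k)) := by
      have := mul_nonneg hη.le h5
      rw [mul_add, mul_div_cancel₀ _ hη.ne'] at this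
      linarith
    rw [hsq] at h6
    have h7 : x ^ 2 * (2 / √(q j)) = 2 * (x ^ 2 / √(q j)) := by ring
    rw [mul_add, h7]
    linarith
  set C := η * (z i - z j) + 2 / √(q j) with hC
  set x := min (√(q j)) (1 / (|C| + 1)) with hx
  have hC1 : 0 < |C| + 1 := by positivity
  have hx0 : 0 < x := lt_min (Real.sqrt_pos.2 hj) (by positivity)
  have hx1 : x ^ 2 ≤ q j := by
    calc x ^ 2 ≤ √(q j) ^ 2 := pow_le_pow_left₀ hx0.le (min_le_left _ _) 2
      _ = q j := Real.sq_sqrt hj.le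
  have hx2 : x * (|C| + 1) ≤ 1 := by
    rw [← le_div_iff₀ hC1]
    exact min_le_right _ _
  have h1 := key x hx0 hx1
  have h2 : x * C ≤ 1 := by nlinarith [le_abs_self C]
  nlinarith

/-- Lowering the cumulative loss of one coordinate increases its probability. -/
theorem ftrl_mono {M : ℕ} [NeZero M] (η : ℝ) (z : Fin M → ℝ) (m : Fin M) {b : ℝ}
    (hb : 0 ≤ b) : ftrl η z m ≤ ftrl η (z - Pi.single m b) m := by
  rcases hb.eq_or_lt with rfl | hb
  · simp
  have h1 := ftrl_isMinOn η z (ftrl_mem η (z - Pi.single m b))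
  have h2 := ftrl_isMinOn η (z - Pi.single m b) (ftrl_mem η z)
  simp only [Set.mem_ofPred_eq, ftrlObjective, Pi.sub_apply, mul_sub, Finset.sum_sub_distrib] at h1 h2
  simp only [Pi.single_apply, mul_ite, mul_zero, Finset.sum_ite_eq', Finset.mem_univ, if_true] at h2
  nlinarith

/-! ### The hedged top algorithm -/

/-- Parameters of the `(1/2, R, β)`-hedged Tsallis-INF algorithm: step size `η`, regret upper
bounds `R` of the base algorithms and thresholds `β`. -/
structure HedgedParams (M : ℕ) where
  η : ℝ
  R : Fin M → ℝ
  β : Fin M → ℝ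
  η_pos : 0 < η
  R_nonneg : ∀ m, 0 ≤ R m

variable {M : ℕ} [NeZero M]

/-- `B_{0,m} = √ρ_{1,m} R_m`, where `ρ_{1,m}⁻¹ = min {β_m, q_{1,m}}` and `q_1 = ftrl η 0`. -/
def initialBias (P : HedgedParams M) (m : Fin M) : ℝ :=
  √((min (P.β m) (ftrl P.η 0 m))⁻¹) * P.R m

/-- The value of `√ρ_{t+1,m} R_m` if the loss of the base `m` played in round `t` is lowered by the
bias `b`. Here `L` is the cumulative loss after round `t`, `B` is the sum of the biases up to round
`t - 1`, and `r = ρ_t⁻¹`. -/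
def hedgedTarget (P : HedgedParams M) (L B r : Fin M → ℝ) (m : Fin M) (b : ℝ) : ℝ :=
  √((min (r m) (ftrl P.η (L - B - Pi.single m b) m))⁻¹) * P.R m

/-- The bias of the base `m` played in round `t`: the (least) `b ≥ 0` for which the cumulative bias
`B_{0,m} + B_m + b` equals `√ρ_{t+1,m} R_m`. It exists by `hedgedBias_spec`, and it is unique as
`hedgedTarget` is antitone in `b`. -/
def hedgedBias (P : HedgedParams M) (L B r : Fin M → ℝ) (m : Fin M) : ℝ :=
  sInf {b | 0 ≤ b ∧ initialBias P m + B m + b = hedgedTarget P L B r m b}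

/-- The state of the top algorithm after `n` rounds: the triple `(L, B, r)` of the cumulative
importance-weighted losses, the cumulative biases `∑_{s ≤ n} b_s` (without `B_0`), and
`r = ρ_n⁻¹`, that is `r m = min {β_m, q_{1,m}, …, q_{n,m}}`. -/
abbrev TopState (M : ℕ) : Type := (Fin M → ℝ) × (Fin M → ℝ) × (Fin M → ℝ)

/-- The distribution over base algorithms that is played in state `s`. -/
def stateProb (P : HedgedParams M) (s : TopState M) : Fin M → ℝ := ftrl P.η (s.1 - s.2.1)

/-- The update of the top algorithm after base `m` has been played and has suffered the loss `x`. -/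
def topStep (P : HedgedParams M) (s : TopState M) (m : Fin M) (x : ℝ) : TopState M :=
  let q := stateProb P s
  let r := fun i => min (s.2.2 i) (q i)
  let L := s.1 + Pi.single m (x / q m)
  (L, s.2.1 + Pi.single m (hedgedBias P L s.2.1 r m), r)

theorem hedgedTarget_antitone (P : HedgedParams M) (L B r : Fin M → ℝ) (m : Fin M) :
    Antitone (hedgedTarget P L B r m) := by
  intro a b hab
  have hq : ftrl P.η (L - B - Pi.single m a) m ≤ ftrl P.η (L - B - Pi.single m b) m := by
    have := ftrl_mono P.η (L - B - Pi.single m a) m (sub_nonneg.2 hab)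
    rwa [sub_sub (L - B), ← Pi.single_add, add_sub_cancel] at this
  unfold hedgedTarget
  refine mul_le_mul_of_nonneg_right ?_ (P.R_nonneg m)
  rcases le_or_gt (r m) 0 with hr | hr
  · rw [Real.sqrt_eq_zero_of_nonpos (inv_nonpos.2 ((min_le_left _ _).trans hr))]
    positivity
  · exact Real.sqrt_le_sqrt (inv_anti₀ (lt_min hr (ftrl_pos P.η_pos _ _)) (min_le_min_left _ hq))

theorem hedgedTarget_continuous (P : HedgedParams M) (L B r : Fin M → ℝ) (m : Fin M) :
    Continuous (hedgedTarget P L B r m) := by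
  have h : Continuous fun b : ℝ => ftrl P.η (L - B - Pi.single m b) m :=
    (continuous_apply m).comp ((continuous_ftrl P.η_pos).comp
      (continuous_const.sub (continuous_single (A := fun _ : Fin M => ℝ) m)))
  unfold hedgedTarget
  rcases le_or_gt (r m) 0 with hr | hr
  · have : ∀ b : ℝ, √((min (r m) (ftrl P.η (L - B - Pi.single m b) m))⁻¹) = 0 := fun b =>
      Real.sqrt_eq_zero_of_nonpos (inv_nonpos.2 ((min_le_left _ _).trans hr))
    simp only [this]
    exact continuous_const
  · exact (Real.continuous_sqrt.comp ((continuous_const.min h).inv₀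
      fun b => (lt_min hr (ftrl_pos P.η_pos _ _)).ne')).mul continuous_const

/-- Existence of the bias: the hedging condition can always be met when the cumulative bias is
not already larger than its target, as is the case in every reachable state. -/
theorem hedgedBias_spec (P : HedgedParams M) (L B r : Fin M → ℝ) (m : Fin M)
    (h : initialBias P m + B m ≤ hedgedTarget P L B r m 0) :
    0 ≤ hedgedBias P L B r m ∧ initialBias P m + B m + hedgedBias P L B r m =
      hedgedTarget P L B r m (hedgedBias P L B r m) := by
  set c := initialBias P m + B m with hc
  set g := hedgedTarget P L B r m with hg
  have hgc : Continuous g := hedgedTarget_continuous P L B r m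
  have hb : (0 : ℝ) ≤ g 0 - c := sub_nonneg.2 h
  obtain ⟨e, he, he'⟩ : (0 : ℝ) ∈ (fun b => c + b - g b) '' Set.Icc 0 (g 0 - c) := by
    refine intermediate_value_Icc hb (by fun_prop) ⟨by simpa using h, ?_⟩
    have := hedgedTarget_antitone P L B r m hb
    simp only [← hg] at this
    linarith
  have hne : Set.Nonempty {b | 0 ≤ b ∧ c + b = g b} := ⟨e, he.1, sub_eq_zero.1 he'⟩
  have hcl : IsClosed {b | 0 ≤ b ∧ c + b = g b} :=
    (isClosed_le continuous_const continuous_id).inter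
      (isClosed_eq (by fun_prop) hgc)
  exact hcl.csInf_mem hne ⟨0, fun b hb => hb.1⟩

theorem hedgedBias_le_iff (P : HedgedParams M) (L B r : Fin M → ℝ) (m : Fin M) (x : ℝ) :
    hedgedBias P L B r m ≤ x ↔ 0 ≤ x ∧ hedgedTarget P L B r m x ≤ initialBias P m + B m + x := by
  have hanti := hedgedTarget_antitone P L B r m
  by_cases h : initialBias P m + B m ≤ hedgedTarget P L B r m 0
  · obtain ⟨h0, h1⟩ := hedgedBias_spec P L B r m h
    constructor
    · intro hx
      have := hanti hx
      exact ⟨h0.trans hx, by linarith⟩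
    · rintro ⟨_, h2⟩
      by_contra! hlt
      have := hanti hlt.le
      linarith
  · have hE : {b | 0 ≤ b ∧ initialBias P m + B m + b = hedgedTarget P L B r m b} = ∅ := by
      refine Set.eq_empty_of_forall_notMem ?_
      rintro b ⟨hb, hb'⟩
      have := hanti hb
      linarith
    have h0 : hedgedBias P L B r m = 0 := by rw [hedgedBias, hE, Real.sInf_empty]
    rw [h0]
    refine ⟨fun hx => ⟨hx, ?_⟩, fun hx => hx.1⟩
    have := hanti hx
    linarith

theorem measurable_stateProb (P : HedgedParams M) : Measurable (stateProb P) := by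
  unfold stateProb
  exact (continuous_ftrl P.η_pos).measurable.comp (by fun_prop)

theorem measurable_hedgedBias (P : HedgedParams M) (m : Fin M) :
    Measurable fun s : TopState M => hedgedBias P s.1 s.2.1 s.2.2 m := by
  refine measurable_of_Iic fun x => ?_
  have : (fun s : TopState M => hedgedBias P s.1 s.2.1 s.2.2 m) ⁻¹' Set.Iic x =
      {s | 0 ≤ x ∧ hedgedTarget P s.1 s.2.1 s.2.2 m x ≤ initialBias P m + s.2.1 m + x} := by
    ext s
    exact hedgedBias_le_iff P s.1 s.2.1 s.2.2 m x
  rw [this]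
  have hq : Measurable fun s : TopState M => ftrl P.η (s.1 - s.2.1 - Pi.single m x) m :=
    (measurable_pi_apply m).comp ((continuous_ftrl P.η_pos).measurable.comp (by fun_prop))
  refine MeasurableSet.inter (MeasurableSet.const _) (measurableSet_le ?_
    (by fun_prop : Measurable fun s : TopState M => initialBias P m + s.2.1 m + x))
  unfold hedgedTarget
  fun_prop

theorem measurable_topStep (P : HedgedParams M) :
    Measurable fun p : (TopState M × ℝ) × Fin M => topStep P p.1.1 p.2 p.1.2 := by
  refine measurable_from_prod_countable_left fun m => ?_
  have hs : Measurable fun x : ℝ => (Pi.single m x : Fin M → ℝ) :=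
    (continuous_single (A := fun _ : Fin M => ℝ) m).measurable
  have hq : Measurable fun p : TopState M × ℝ => stateProb P p.1 :=
    (measurable_stateProb P).comp measurable_fst
  have hL : Measurable fun p : TopState M × ℝ =>
      p.1.1 + Pi.single m (p.2 / stateProb P p.1 m) := by
    have : Measurable fun p : TopState M × ℝ => p.2 / stateProb P p.1 m := by fun_prop
    exact (by fun_prop : Measurable fun p : TopState M × ℝ => p.1.1).add (hs.comp this)
  have hr : Measurable fun p : TopState M × ℝ =>
      fun i => min (p.1.2.2 i) (stateProb P p.1 i) := by fun_prop
  have hB : Measurable fun p : TopState M × ℝ => p.1.2.1 := by fun_prop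
  exact hL.prodMk ((hB.add (hs.comp
    ((measurable_hedgedBias P m).comp (hL.prodMk (hB.prodMk hr))))).prodMk hr)

/-! ### Base algorithms, environments and their interaction with the top algorithm -/

/-- The record of one round: the context, the loss vector with entries in `[0, 1]`, the selected
base algorithm, and the arm it plays. -/
abbrev Round (X : Type*) (K M : ℕ) : Type _ :=
  ((X × (Fin K → Set.Icc (0 : ℝ) 1)) × Fin M) × Fin K

namespace Round

variable {X : Type*} {K M : ℕ}

def context (ω : Round X K M) : X := ω.1.1.1

def loss (ω : Round X K M) (a : Fin K) : ℝ := ω.1.1.2 a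

def base (ω : Round X K M) : Fin M := ω.1.2

def arm (ω : Round X K M) : Fin K := ω.2

end Round

/-- An adaptive adversary: the joint law of the next context and loss vector may depend on
everything that happened in the first `n` rounds. -/
structure Environment (X : Type*) [MeasurableSpace X] (K M : ℕ) where
  next : (n : ℕ) → Kernel (Fin n → Round X K M) (X × (Fin K → Set.Icc (0 : ℝ) 1))
  markov : ∀ n, IsMarkovKernel (next n)

/-- What a base algorithm observes in a round: the context and, if it was selected, the arm it
played together with the (importance-weighted) loss it was fed. -/
abbrev BaseObs (X : Type*) (K : ℕ) : Type _ := X × (Unit ⊕ (Fin K × ℝ))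

/-- A base algorithm: a finite nonempty class of policies that it competes with, and the law of the
arm that it plays, when selected, given its observations in the first `n` rounds and the current
context. -/
structure BaseAlgorithm (X : Type*) [MeasurableSpace X] (K : ℕ) where
  policies : Finset (X → Fin K)
  nonempty : policies.Nonempty
  measurable_policies : ∀ π ∈ policies, Measurable π
  act : (n : ℕ) → Kernel ((Fin n → BaseObs X K) × X) (Fin K)
  markov : ∀ n, IsMarkovKernel (act n)

variable {X : Type*} [MeasurableSpace X] {K : ℕ}

/-- The state of the top algorithm as a function of the history of the first `n` rounds. -/
def topState (P : HedgedParams M) : (n : ℕ) → (Fin n → Round X K M) → TopState M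
  | 0, _ => (0, 0, P.β)
  | n + 1, h =>
    let ω := h (Fin.last n)
    topStep P (topState P n fun i => h i.castSucc) ω.base (ω.loss ω.arm)

/-- `q_{n+1}`: the distribution over base algorithms after the first `n` rounds. -/
def topProb (P : HedgedParams M) (n : ℕ) (h : Fin n → Round X K M) : Fin M → ℝ :=
  stateProb P (topState P n h)

/-- The history before round `s`. -/
def before {n : ℕ} (h : Fin n → Round X K M) (s : Fin n) : Fin s → Round X K M :=
  fun i => h (Fin.castLE s.isLt.le i)

/-- `√ρ_{n,m}`, where `ρ_{n,m}⁻¹ = min {β_m, min_{s ≤ n} q_{s,m}}`. -/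
def sqrtRho (P : HedgedParams M) (n : ℕ) (h : Fin n → Round X K M) (m : Fin M) : ℝ :=
  √(((topState P n h).2.2 m)⁻¹)

/-- The observations of base algorithm `m`: when selected in round `s`, it is fed the
importance-weighted loss `ℓ_{s,A_s} / q_{s,m}`. -/
def baseObs (P : HedgedParams M) (m : Fin M) (n : ℕ) (h : Fin n → Round X K M) :
    Fin n → BaseObs X K :=
  fun s => ((h s).context,
    if (h s).base = m then
      Sum.inr ((h s).arm, (h s).loss (h s).arm / topProb P s (before h s) m)
    else Sum.inl ())

theorem measurable_observedLoss {M : ℕ} :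
    Measurable fun ω : Round X K M => ω.loss ω.arm := by
  refine measurable_from_prod_countable_left fun a => ?_
  have : Measurable fun p : (X × (Fin K → Set.Icc (0 : ℝ) 1)) × Fin M => p.1.2 a :=
    (measurable_pi_apply a).comp (measurable_snd.comp measurable_fst)
  exact measurable_subtype_coe.comp this

theorem measurable_topState (P : HedgedParams M) (n : ℕ) :
    Measurable (topState P n : (Fin n → Round X K M) → TopState M) := by
  induction n with
  | zero => exact measurable_const
  | succ n ih =>
    have h1 : Measurable fun h : Fin (n + 1) → Round X K M => fun i : Fin n => h i.castSucc := by
      fun_prop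
    have h2 : Measurable fun h : Fin (n + 1) → Round X K M => h (Fin.last n) := by fun_prop
    exact (measurable_topStep P).comp (((ih.comp h1).prodMk (measurable_observedLoss.comp h2)).prodMk
      (measurable_snd.comp (measurable_fst.comp h2)))

theorem measurable_topProb (P : HedgedParams M) (n : ℕ) :
    Measurable (topProb P n : (Fin n → Round X K M) → Fin M → ℝ) :=
  (measurable_stateProb P).comp (measurable_topState P n)

theorem measurable_baseObs (P : HedgedParams M) (m : Fin M) (n : ℕ) :
    Measurable (baseObs P m n : (Fin n → Round X K M) → Fin n → BaseObs X K) := by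
  refine measurable_pi_lambda _ fun s => ?_
  have hs : Measurable fun h : Fin n → Round X K M => h s := measurable_pi_apply s
  have hb : Measurable fun h : Fin n → Round X K M => (h s).base :=
    measurable_snd.comp (measurable_fst.comp hs)
  have hq : Measurable fun h : Fin n → Round X K M => topProb P s (before h s) m := by
    refine (measurable_pi_apply m).comp ((measurable_topProb P s).comp ?_)
    unfold before
    fun_prop
  refine Measurable.prodMk (measurable_fst.comp (measurable_fst.comp (measurable_fst.comp hs))) ?_
  refine Measurable.ite (hb (measurableSet_singleton m)) (measurable_inr.comp ?_) measurable_const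
  exact (measurable_snd.comp hs).prodMk ((measurable_observedLoss.comp hs).div hq)

/-- The top algorithm draws the base algorithm `M_{n+1}` from `q_{n+1}`. -/
def topKernel (P : HedgedParams M) (n : ℕ) : Kernel (Fin n → Round X K M) (Fin M) where
  toFun h := ∑ m, ENNReal.ofReal (topProb P n h m) • Measure.dirac m
  measurable' := by
    refine Measure.measurable_of_measurable_coe _ fun s _ => ?_
    simp only [Measure.coe_finsetSum, Finset.sum_apply, Measure.smul_apply, smul_eq_mul]
    refine Finset.measurable_sum _ fun m _ => Measurable.mul_const ?_ _
    exact ((measurable_pi_apply m).comp (measurable_topProb P n)).ennreal_ofReal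

instance (P : HedgedParams M) (n : ℕ) :
    IsMarkovKernel (topKernel P n : Kernel (Fin n → Round X K M) (Fin M)) where
  isProbabilityMeasure h := by
    constructor
    have hq : topProb P n h ∈ stdSimplex ℝ (Fin M) := ftrl_mem _ _
    change (∑ m, ENNReal.ofReal (topProb P n h m) • Measure.dirac m : Measure (Fin M)) Set.univ = 1
    simp only [Measure.coe_finsetSum, Finset.sum_apply, Measure.smul_apply, smul_eq_mul,
      measure_univ, mul_one]
    rw [← ENNReal.ofReal_sum_of_nonneg fun m _ => hq.1 m, hq.2, ENNReal.ofReal_one]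

/-- The selected base algorithm draws its arm from its own observations and the current context. -/
def armKernel (P : HedgedParams M) (𝓑 : Fin M → BaseAlgorithm X K) (n : ℕ) :
    Kernel ((Fin n → Round X K M) × ((X × (Fin K → Set.Icc (0 : ℝ) 1)) × Fin M)) (Fin K) where
  toFun p := (𝓑 p.2.2).act n (baseObs P p.2.2 n p.1, p.2.1.1)
  measurable' := by
    have h : Measurable fun p : ((Fin n → Round X K M) × X) × Fin M =>
        (𝓑 p.2).act n (baseObs P p.2 n p.1.1, p.1.2) := by
      refine measurable_from_prod_countable_left fun m => ?_
      exact ((𝓑 m).act n).measurable.comp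
        (((measurable_baseObs P m n).comp measurable_fst).prodMk measurable_snd)
    exact h.comp (by fun_prop : Measurable fun p : (Fin n → Round X K M) ×
      ((X × (Fin K → Set.Icc (0 : ℝ) 1)) × Fin M) => ((p.1, p.2.1.1), p.2.2))

instance (P : HedgedParams M) (𝓑 : Fin M → BaseAlgorithm X K) (n : ℕ) :
    IsMarkovKernel (armKernel P 𝓑 n) where
  isProbabilityMeasure p :=
    ((𝓑 p.2.2).markov n).isProbabilityMeasure (baseObs P p.2.2 n p.1, p.2.1.1)

instance (E : Environment X K M) (n : ℕ) : IsMarkovKernel (E.next n) := E.markov n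

/-- The law of the next round given the history: given the past, the environment and the top
algorithm move independently, and then the selected base algorithm plays. -/
def roundKernel (P : HedgedParams M) (𝓑 : Fin M → BaseAlgorithm X K) (E : Environment X K M)
    (n : ℕ) : Kernel (Fin n → Round X K M) (Round X K M) :=
  (E.next n ×ₖ topKernel P n) ⊗ₖ armKernel P 𝓑 n

instance (P : HedgedParams M) (𝓑 : Fin M → BaseAlgorithm X K) (E : Environment X K M) (n : ℕ) :
    IsMarkovKernel (roundKernel P 𝓑 E n) := by
  unfold roundKernel
  infer_instance

/-- The law of the first `n` rounds when the hedged top algorithm runs on the base algorithms `𝓑`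
in the environment `E`. -/
def law (P : HedgedParams M) (𝓑 : Fin M → BaseAlgorithm X K) (E : Environment X K M) :
    (n : ℕ) → Measure (Fin n → Round X K M)
  | 0 => Measure.dirac Fin.elim0
  | n + 1 => (law P 𝓑 E n ⊗ₘ roundKernel P 𝓑 E n).map
      fun p => (Fin.snoc p.1 p.2 : Fin (n + 1) → Round X K M)

theorem measurable_snoc {M : ℕ} (n : ℕ) :
    Measurable fun p : (Fin n → Round X K M) × Round X K M =>
      (Fin.snoc p.1 p.2 : Fin (n + 1) → Round X K M) := by
  refine measurable_pi_lambda _ fun i => ?_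
  induction i using Fin.lastCases with
  | last => simpa using measurable_snd
  | cast i => simpa [Function.comp_def] using (measurable_pi_apply i).comp (measurable_fst (α := Fin n → Round X K M) (β := Round X K M))

instance (P : HedgedParams M) (𝓑 : Fin M → BaseAlgorithm X K) (E : Environment X K M) (n : ℕ) :
    IsProbabilityMeasure (law P 𝓑 E n) := by
  induction n with
  | zero => exact Measure.dirac.isProbabilityMeasure
  | succ n ih => exact Measure.isProbabilityMeasure_map (measurable_snoc n).aemeasurable

/-- `Reg(T, 𝓑_m)`: the expected regret after `T` rounds of the hedged algorithm against the best
policy in the class of the base algorithm `𝓑_m`. -/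
def regret (P : HedgedParams M) (𝓑 : Fin M → BaseAlgorithm X K) (E : Environment X K M)
    (T : ℕ) (m : Fin M) : ℝ :=
  (𝓑 m).policies.sup' (𝓑 m).nonempty fun π =>
    ∫ h, ∑ t, ((h t).loss (h t).arm - (h t).loss (π (h t).context)) ∂(law P 𝓑 E T)

/-- The regret of the base algorithm `𝓑_m` under the importance-weighted losses
`𝟙(M_t = m) / q_{t,m} · ℓ_t` that the hedged algorithm feeds to it. -/
def importanceWeightedRegret (P : HedgedParams M) (𝓑 : Fin M → BaseAlgorithm X K)
    (E : Environment X K M) (T : ℕ) (m : Fin M) : ℝ :=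
  (𝓑 m).policies.sup' (𝓑 m).nonempty fun π =>
    ∫ h, ∑ t, (if (h t).base = m then
      ((h t).loss (h t).arm - (h t).loss (π (h t).context)) / topProb P t (before h t) m
      else 0) ∂(law P 𝓑 E T)

end HedgedTsallis

end

/-! The proof has a pathwise part and a probabilistic part.

Pathwise, let `V z` be the minimum of the FTRL objective at cumulative loss `z`, and let base `i` be
played with observed loss `x`, so that its estimated loss is `y = x / q i`. Stability of the Tsallis
potential (`ftrl_stability`) bounds `x` by the growth of `V` from `z` to `z + y e_i` plus `η x² /
√(q i)`. Subtracting the bias `b` then lowers `V` by at most `b q' i`, because `V` is concave with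
gradient `q'` at the new point. A positive bias forces `1/ρ = q' i` after the round, so `b q' i` is
at most the decrease of the potential `∑ R / √ρ` (`sqrt_inv_gap`). Summed over rounds
(`topState_bound`), the biases therefore cost at most `∑ √β R` in total. Against base `m`, however,
they earn their full sum, which by the hedging identity is at least `√ρ R - √(1/β) R` in coordinate
`m`. This is `hedged_regret_bound`.

In expectation, the importance-weighted loss of a fixed policy is unbiased
(`integral_importanceWeighted`), and the stability terms average to at most `η √M` per round
(`integral_inv_sqrt_prob`). The regret of base `m` on its weighted losses is at most the expectation
of `√ρ R` by hypothesis, so it is cancelled by the hedging term (`integral_le_of_hedged`). What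
remains is deterministic, and `η` and `β` are tuned to balance it. -/

namespace HedgedTsallis

noncomputable section

/-! ### Optimality conditions and monotonicity of the FTRL distribution -/

/-- First order optimality of the FTRL distribution. -/
theorem ftrl_first_order {M : ℕ} [NeZero M] {η : ℝ} (hη : 0 < η) (z p : Fin M → ℝ)
    (hp : p ∈ stdSimplex ℝ (Fin M)) :
    0 ≤ ∑ i, (p i - ftrl η z i) * (z i - 1 / (η * √(ftrl η z i))) := by
  set q := ftrl η z with hq
  have hqm : q ∈ stdSimplex ℝ (Fin M) := ftrl_mem η z
  have hq0 : ∀ i, 0 < q i := ftrl_pos hη z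
  set A := ∑ i, (p i - q i) * (z i - 1 / (η * √(q i))) with hA
  set D := ∑ i, (p i - q i) ^ 2 / (q i * √(q i)) / η with hD
  have hD0 : 0 ≤ D := Finset.sum_nonneg fun i _ => by have := hq0 i; positivity
  have key : ∀ x : ℝ, 0 < x → x ≤ 1 → 0 ≤ A + x * D := by
    intro x hx hx1
    set r : Fin M → ℝ := fun i => q i + x * (p i - q i) with hr
    have hr0 : ∀ i, 0 ≤ r i := fun i => by
      have h1 := hp.1 i
      have h2 := (hq0 i).le
      have : r i = (1 - x) * q i + x * p i := by simp only [hr]; ring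
      rw [this]
      have : 0 ≤ 1 - x := by linarith
      positivity
    have hrm : r ∈ stdSimplex ℝ (Fin M) := by
      refine ⟨hr0, ?_⟩
      simp only [hr, Finset.sum_add_distrib, ← Finset.mul_sum, Finset.sum_sub_distrib, hp.2, hqm.2]
      ring
    have hmin : ftrlObjective η z q ≤ ftrlObjective η z r := ftrl_isMinOn η z hrm
    -- A global second-order lower bound for the square root around `q i`, valid down to `r i = 0`.
    -- It makes the error of the directional derivative an explicit `x * D`, so no calculus is
    -- needed.
    have hs : ∀ i, √(q i) + x * (p i - q i) / (2 * √(q i)) -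
        x ^ 2 * (p i - q i) ^ 2 / (2 * (q i * √(q i))) ≤ √(r i) := by
      intro i
      have hs0 := Real.sqrt_pos.2 (hq0 i)
      have hu0 := Real.sqrt_nonneg (r i)
      have e1 : q i = √(q i) ^ 2 := (Real.sq_sqrt (hq0 i).le).symm
      have e2 : x * (p i - q i) = √(r i) ^ 2 - √(q i) ^ 2 := by
        rw [Real.sq_sqrt (hr0 i), Real.sq_sqrt (hq0 i).le]; simp [hr]
      rw [← mul_pow, e2]
      generalize √(r i) = u at *
      generalize √(q i) = s at *
      rw [e1]
      have : u - (s + (u ^ 2 - s ^ 2) / (2 * s) - (u ^ 2 - s ^ 2) ^ 2 / (2 * (s ^ 2 * s))) =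
          (u - s) ^ 2 * (u * (u + 2 * s)) / (2 * s ^ 3) := by
        field_simp
        ring
      have h3 : 0 ≤ (u - s) ^ 2 * (u * (u + 2 * s)) / (2 * s ^ 3) := by positivity
      linarith
    unfold ftrlObjective tsallisPotential at hmin
    have h1 : ∑ i, r i * z i = ∑ i, q i * z i + x * ∑ i, (p i - q i) * z i := by
      rw [Finset.mul_sum, ← Finset.sum_add_distrib]
      exact Finset.sum_congr rfl fun i _ => by simp only [hr]; ring
    have h2 : x * (A + x * D) = x * ∑ i, (p i - q i) * z i - 2 / η * ∑ i,
        (x * (p i - q i) / (2 * √(q i)) - x ^ 2 * (p i - q i) ^ 2 / (2 * (q i * √(q i)))) := by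
      rw [hA, hD, mul_add, Finset.mul_sum, Finset.mul_sum, Finset.mul_sum, Finset.mul_sum,
        Finset.mul_sum, ← Finset.sum_add_distrib, ← Finset.sum_sub_distrib]
      refine Finset.sum_congr rfl fun i _ => ?_
      have hs0 := Real.sqrt_pos.2 (hq0 i)
      have := hq0 i
      field_simp
      ring
    have h3 : ∑ i, √(q i) + ∑ i, (x * (p i - q i) / (2 * √(q i)) -
        x ^ 2 * (p i - q i) ^ 2 / (2 * (q i * √(q i)))) ≤ ∑ i, √(r i) := by
      rw [← Finset.sum_add_distrib]
      exact Finset.sum_le_sum fun i _ => by linarith [hs i]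
    have h4 : 2 / η * ∑ i, (x * (p i - q i) / (2 * √(q i)) -
        x ^ 2 * (p i - q i) ^ 2 / (2 * (q i * √(q i)))) ≤
        2 / η * (∑ i, √(r i) - ∑ i, √(q i)) :=
      mul_le_mul_of_nonneg_left (by linarith) (by positivity)
    have h5 : 2 / η * (∑ i, √(r i) - ∑ i, √(q i)) =
      -2 * (∑ i, √(q i)) / η - -2 * (∑ i, √(r i)) / η := by ring
    exact nonneg_of_mul_nonneg_right (by rw [h2]; linarith) hx
  by_contra! hneg
  -- If `A < 0`, this `x` gives `x * D ≤ -A / 2`, hence `A + x * D ≤ A / 2 < 0`. The `+ 1` covers `D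
  -- = 0`.
  have h := key (min 1 (-A / (2 * (D + 1)))) (lt_min one_pos (div_pos (by linarith) (by linarith)))
    (min_le_left _ _)
  have h1 : min 1 (-A / (2 * (D + 1))) * D ≤ -A / (2 * (D + 1)) * (D + 1) :=
    mul_le_mul (min_le_right _ _) (by linarith) hD0 (div_nonneg (by linarith) (by linarith))
  have h2 : -A / (2 * (D + 1)) * (D + 1) = -A / 2 := by field_simp
  linarith

/-- The KKT condition: the gradient of the FTRL objective is constant at the minimizer. -/
theorem ftrl_kkt {M : ℕ} [NeZero M] {η : ℝ} (hη : 0 < η) (z : Fin M → ℝ) (i j : Fin M) :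
    z i - 1 / (η * √(ftrl η z i)) = z j - 1 / (η * √(ftrl η z j)) := by
  set q := ftrl η z with hq
  have hqm : q ∈ stdSimplex ℝ (Fin M) := ftrl_mem η z
  have hq0 : ∀ i, 0 < q i := ftrl_pos hη z
  set g : Fin M → ℝ := fun i => z i - 1 / (η * √(q i)) with hg
  -- Testing optimality at the vertices shows that no gradient entry lies below the `q`-average.
  -- Since all weights are positive, every entry equals it.
  have h1 : ∀ k, 0 ≤ g k - ∑ i, q i * g i := by
    intro k
    have := ftrl_first_order hη z _ (single_mem_stdSimplex ℝ k)
    rw [← hq] at this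
    simp only [sub_mul, Finset.sum_sub_distrib, Pi.single_apply, ite_mul, one_mul, zero_mul,
      Finset.sum_ite_eq', Finset.mem_univ, if_true] at this
    exact this
  have h2 : ∑ k, q k * (g k - ∑ i, q i * g i) = 0 := by
    simp only [mul_sub, Finset.sum_sub_distrib, ← Finset.sum_mul, hqm.2, one_mul, sub_self]
  have h3 := (Finset.sum_eq_zero_iff_of_nonneg
    fun k _ => mul_nonneg (hq0 k).le (h1 k)).1 h2
  have h4 : ∀ k, g k = ∑ i, q i * g i := fun k =>
    sub_eq_zero.1 ((mul_eq_zero.1 (h3 k (Finset.mem_univ k))).resolve_left (hq0 k).ne')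
  exact (h4 i).trans (h4 j).symm

/-- At `z = 0` the KKT condition makes all coordinates equal. -/
theorem ftrl_zero {M : ℕ} [NeZero M] {η : ℝ} (hη : 0 < η) (i : Fin M) :
    ftrl η 0 i = 1 / (M : ℝ) := by
  have hM : (M : ℝ) ≠ 0 := NeZero.ne _
  have h : ∀ j, ftrl η (0 : Fin M → ℝ) j = ftrl η 0 i := by
    intro j
    have h1 := ftrl_kkt hη (0 : Fin M → ℝ) i j
    have hi := ftrl_pos hη (0 : Fin M → ℝ) i
    have hj := ftrl_pos hη (0 : Fin M → ℝ) j
    simp only [Pi.zero_apply, zero_sub, neg_inj, one_div, inv_inj] at h1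
    exact ((Real.sqrt_inj hi.le hj.le).1 (mul_left_cancel₀ hη.ne' h1)).symm
  have h2 := (ftrl_mem η (0 : Fin M → ℝ)).2
  rw [Finset.sum_congr rfl fun j _ => h j] at h2
  simp only [Finset.sum_const, Finset.card_univ, Fintype.card_fin, nsmul_eq_mul] at h2
  field_simp
  linarith

/-- Raising the cumulative loss of one coordinate increases the probability of the others. -/
theorem ftrl_mono_other {M : ℕ} [NeZero M] {η : ℝ} (hη : 0 < η) (z : Fin M → ℝ) {i m : Fin M}
    (him : m ≠ i) {c : ℝ} (hc : 0 ≤ c) : ftrl η z m ≤ ftrl η (z + Pi.single i c) m := by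
  have hi := ftrl_mono η (z + Pi.single i c) i hc
  rw [add_sub_cancel_right] at hi
  have hkq := fun j => ftrl_kkt hη z j m
  have hkp := fun j => ftrl_kkt hη (z + Pi.single i c) j m
  have hq0 := ftrl_pos hη z
  have hp0 := ftrl_pos hη (z + Pi.single i c)
  have hqs := (ftrl_mem η z).2
  have hps := (ftrl_mem η (z + Pi.single i c)).2
  generalize ftrl η z = q at *
  generalize ftrl η (z + Pi.single i c) = p at *
  by_contra! hlt
  -- If coordinate `m` lost mass, the common KKT multiplier would push down every other coordinate
  -- except `i`, and `i` falls by `ftrl_mono`. The total mass would then drop below one.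
  have hall : ∀ j, p j ≤ q j := by
    intro j
    by_cases hji : j = i
    · rw [hji]; exact hi
    have h1 := hkq j
    have h2 := hkp j
    rw [Pi.add_apply, Pi.add_apply, Pi.single_eq_of_ne hji, Pi.single_eq_of_ne him, add_zero,
      add_zero] at h2
    have h3 : 1 / (η * √(q m)) < 1 / (η * √(p m)) :=
      one_div_lt_one_div_of_lt (mul_pos hη (Real.sqrt_pos.2 (hp0 m)))
        (mul_lt_mul_of_pos_left (Real.sqrt_lt_sqrt (hp0 m).le hlt) hη)
    have h4 : 1 / (η * √(q j)) < 1 / (η * √(p j)) := by linarith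
    have h5 := lt_of_one_div_lt_one_div (mul_pos hη (Real.sqrt_pos.2 (hq0 j))) h4
    exact ((Real.sqrt_lt_sqrt_iff (hp0 j).le).1 (lt_of_mul_lt_mul_left h5 hη.le)).le
  have := Finset.sum_lt_sum (fun j _ => hall j) ⟨m, Finset.mem_univ m, hlt⟩
  rw [hqs, hps] at this
  exact lt_irrefl _ this

/-! ### The FTRL value function and its stability -/

theorem sum_sqrt_le {M : ℕ} {q : Fin M → ℝ} (hq : q ∈ stdSimplex ℝ (Fin M)) :
    ∑ i, √(q i) ≤ √M := by
  refine Real.le_sqrt_of_sq_le ?_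
  have := sq_sum_le_card_mul_sum_sq (s := Finset.univ) (f := fun i => √(q i))
  rwa [Finset.sum_congr rfl fun i _ => Real.sq_sqrt (hq.1 i), hq.2, Finset.card_univ,
    Fintype.card_fin, mul_one] at this

/-- The minimal value of the FTRL objective. -/
def ftrlValue {M : ℕ} [NeZero M] (η : ℝ) (z : Fin M → ℝ) : ℝ := ftrlObjective η z (ftrl η z)

theorem ftrlValue_zero_ge {M : ℕ} [NeZero M] {η : ℝ} (hη : 0 < η) :
    -(2 * √M / η) ≤ ftrlValue η (0 : Fin M → ℝ) := by
  have h := sum_sqrt_le (ftrl_mem η (0 : Fin M → ℝ))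
  have h1 : 2 * (∑ i, √(ftrl η (0 : Fin M → ℝ) i)) / η ≤ 2 * √M / η := by gcongr
  have h2 : ftrlValue η (0 : Fin M → ℝ) = -(2 * (∑ i, √(ftrl η (0 : Fin M → ℝ) i)) / η) := by
    simp only [ftrlValue, ftrlObjective, tsallisPotential, Pi.zero_apply, mul_zero,
      Finset.sum_const_zero]
    ring
  linarith

/-- Compare with the vertex `m`, where the potential is nonpositive. This is where the comparator
base enters. -/
theorem ftrlValue_le {M : ℕ} [NeZero M] {η : ℝ} (hη : 0 < η) (z : Fin M → ℝ) (m : Fin M) :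
    ftrlValue η z ≤ z m := by
  have h : ftrlValue η z ≤ ftrlObjective η z (Pi.single m 1) :=
    ftrl_isMinOn η z (single_mem_stdSimplex ℝ m)
  have h1 : ftrlObjective η z (Pi.single m 1) ≤ z m := by
    have : 0 ≤ 2 * (∑ i, √((Pi.single m 1 : Fin M → ℝ) i)) / η := by positivity
    simp only [ftrlObjective, tsallisPotential]
    have e : ∑ i, (Pi.single m 1 : Fin M → ℝ) i * z i = z m := by simp [Pi.single_apply]
    rw [e]
    have e2 : -2 * (∑ i, √((Pi.single m 1 : Fin M → ℝ) i)) / η =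
      -(2 * (∑ i, √((Pi.single m 1 : Fin M → ℝ) i)) / η) := by ring
    rw [e2]
    linarith
  exact h.trans h1

theorem ftrlObjective_add_single {M : ℕ} (η : ℝ) (z q : Fin M → ℝ) (i : Fin M) (c : ℝ) :
    ftrlObjective η (z + Pi.single i c) q = ftrlObjective η z q + q i * c := by
  simp only [ftrlObjective, Pi.add_apply, mul_add, Finset.sum_add_distrib, Pi.single_apply,
    mul_ite, mul_zero, Finset.sum_ite_eq', Finset.mem_univ, if_true]
  ring

/-- The value function is concave. -/
theorem ftrlValue_add_single_le {M : ℕ} [NeZero M] (η : ℝ) (z : Fin M → ℝ) (i : Fin M) (c : ℝ) :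
    ftrlValue η (z + Pi.single i c) ≤ ftrlValue η z + ftrl η z i * c := by
  rw [ftrlValue, ftrlValue, ← ftrlObjective_add_single]
  exact ftrl_isMinOn η _ (ftrl_mem η z)

/-- Stability of FTRL under a nonnegative loss in one coordinate. -/
theorem ftrl_stability {M : ℕ} [NeZero M] {η : ℝ} (hη : 0 < η) (z : Fin M → ℝ) (i : Fin M)
    {y : ℝ} (hy : 0 ≤ y) :
    ftrl η z i * y ≤ ftrlValue η (z + Pi.single i y) - ftrlValue η z +
      η * (ftrl η z i * √(ftrl η z i)) * y ^ 2 := by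
  set q := ftrl η z with hq
  set p := ftrl η (z + Pi.single i y) with hp
  have hq0 : ∀ i, 0 < q i := ftrl_pos hη z
  have hp0 : ∀ i, 0 < p i := ftrl_pos hη _
  have hfo := ftrl_first_order hη z p (ftrl_mem η _)
  rw [← hq] at hfo
  have hV : ftrlValue η (z + Pi.single i y) - ftrlValue η z = p i * y +
      ∑ j, ((p j - q j) * z j + 2 * (√(q j) - √(p j)) / η) := by
    rw [ftrlValue, ftrlValue, ← hq, ← hp, ftrlObjective_add_single, Finset.sum_add_distrib,
      ← Finset.sum_div, ← Finset.mul_sum]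
    simp only [ftrlObjective, tsallisPotential, sub_mul, Finset.sum_sub_distrib]
    ring
  -- The change of the objective splits into the first-order term, nonnegative by optimality of `q`,
  -- and the Bregman divergence of the Tsallis potential. Only coordinate `i` of the divergence is
  -- kept.
  have hD : ∑ j, ((p j - q j) * z j + 2 * (√(q j) - √(p j)) / η) =
      ∑ j, (p j - q j) * (z j - 1 / (η * √(q j))) +
      ∑ j, (√(q j) - √(p j)) ^ 2 / (η * √(q j)) := by
    rw [← Finset.sum_add_distrib]
    refine Finset.sum_congr rfl fun j _ => ?_
    have hs0 := Real.sqrt_pos.2 (hq0 j)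
    have e1 : q j = √(q j) ^ 2 := (Real.sq_sqrt (hq0 j).le).symm
    have e2 : p j = √(p j) ^ 2 := (Real.sq_sqrt (hp0 j).le).symm
    generalize √(q j) = s at *
    generalize √(p j) = u at *
    rw [e1, e2]
    field_simp
    ring
  have hsingle : (√(q i) - √(p i)) ^ 2 / (η * √(q i)) ≤
      ∑ j, (√(q j) - √(p j)) ^ 2 / (η * √(q j)) :=
    Finset.single_le_sum (f := fun j => (√(q j) - √(p j)) ^ 2 / (η * √(q j)))
      (fun j _ => by positivity) (Finset.mem_univ i)
  have hpq : √(p i) ≤ √(q i) := Real.sqrt_le_sqrt (by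
    have := ftrl_mono η (z + Pi.single i y) i hy
    rwa [add_sub_cancel_right] at this)
  have hfin : (q i - p i) * y - (√(q i) - √(p i)) ^ 2 / (η * √(q i)) ≤
      η * (q i * √(q i)) * y ^ 2 := by
    have hs0 := Real.sqrt_pos.2 (hq0 i)
    have hu0 := Real.sqrt_nonneg (p i)
    have e1 : q i = √(q i) ^ 2 := (Real.sq_sqrt (hq0 i).le).symm
    have e2 : p i = √(p i) ^ 2 := (Real.sq_sqrt (hp0 i).le).symm
    generalize √(q i) = s at *
    generalize √(p i) = u at *
    rw [e1, e2]
    -- Uses `s + u ≤ 2 s`. The divergence then absorbs the linear term by completing the square.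
    have h1 : (s ^ 2 - u ^ 2) * y ≤ 2 * s * (s - u) * y := by
      refine mul_le_mul_of_nonneg_right ?_ hy
      nlinarith
    have h2 : η * (s ^ 2 * s) * y ^ 2 - 2 * s * (s - u) * y + (s - u) ^ 2 / (η * s) =
        (s - u - η * s ^ 2 * y) ^ 2 / (η * s) := by
      field_simp
      ring
    have h3 : 0 ≤ (s - u - η * s ^ 2 * y) ^ 2 / (η * s) := by positivity
    linarith
  linarith

/-! ### The hedging invariant and the pathwise regret bound -/

section

variable {M : ℕ} [NeZero M]

/-- The hedging condition: the cumulative bias of every base algorithm is `√ρ R`. -/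
def IsHedged (P : HedgedParams M) (s : TopState M) : Prop :=
  ∀ m, 0 < s.2.2 m ∧
    initialBias P m + s.2.1 m = √((min (s.2.2 m) (stateProb P s m))⁻¹) * P.R m

/-- The optimal value of the FTRL objective in a state of the top algorithm. -/
def stateValue (P : HedgedParams M) (s : TopState M) : ℝ := ftrlValue P.η (s.1 - s.2.1)

/-- The potential `∑ R / √ρ` that pays for the biases. -/
def biasPotential (P : HedgedParams M) (s : TopState M) : ℝ :=
  ∑ m, √(min (s.2.2 m) (stateProb P s m)) * P.R m

theorem stateProb_pos (P : HedgedParams M) (s : TopState M) (m : Fin M) : 0 < stateProb P s m :=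
  ftrl_pos P.η_pos _ m

theorem stateProb_topStep (P : HedgedParams M) (s : TopState M) (i : Fin M) (x : ℝ) :
    (topStep P s i x).1 - (topStep P s i x).2.1 = (s.1 - s.2.1) +
      Pi.single i (x / stateProb P s i - hedgedBias P (s.1 + Pi.single i (x / stateProb P s i))
        s.2.1 (fun j => min (s.2.2 j) (stateProb P s j)) i) := by
  simp only [topStep, Pi.single_sub]
  abel

/-- With `a = √u` and `b = √v`, the right side exceeds the left by `R (b - a)² / b`. For `u` and `v`
the values of `1/ρ` after and before an update, the left side is the price of the bias and the right
side the drop of `biasPotential`. -/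
theorem sqrt_inv_gap {R u v : ℝ} (hR : 0 ≤ R) (hu : 0 < u) (hv : 0 < v) :
    (√(u⁻¹) * R - √(v⁻¹) * R) * u ≤ √v * R - √u * R := by
  have hu0 := Real.sqrt_pos.2 hu
  have hv0 := Real.sqrt_pos.2 hv
  have e1 : u = √u ^ 2 := (Real.sq_sqrt hu.le).symm
  rw [Real.sqrt_inv, Real.sqrt_inv]
  generalize √v = b at *
  generalize √u = a at *
  rw [e1, ← sub_mul, ← sub_mul, mul_right_comm]
  refine mul_le_mul_of_nonneg_right ?_ hR
  have : b - a - (a⁻¹ - b⁻¹) * a ^ 2 = (b - a) ^ 2 / b := by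
    field_simp
  have h2 : 0 ≤ (b - a) ^ 2 / b := by positivity
  linarith

/-- One round of the top algorithm preserves the hedging condition, and its loss is controlled by
the increments of the potentials. -/
theorem topStep_spec (P : HedgedParams M) {s : TopState M} (hs : IsHedged P s) (i : Fin M) {x : ℝ}
    (hx : 0 ≤ x) :
    IsHedged P (topStep P s i x) ∧
      x ≤ stateValue P (topStep P s i x) - stateValue P s +
        (biasPotential P s - biasPotential P (topStep P s i x)) +
        P.η * x ^ 2 / √(stateProb P s i) := by
  set q := stateProb P s with hq
  have hq0 : ∀ j, 0 < q j := stateProb_pos P s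
  set z := s.1 - s.2.1 with hz
  set y := x / q i with hy
  have hy0 : 0 ≤ y := div_nonneg hx (hq0 i).le
  set r : Fin M → ℝ := fun j => min (s.2.2 j) (q j) with hr
  have hr0 : ∀ j, 0 < r j := fun j => lt_min (hs j).1 (hq0 j)
  set L := s.1 + Pi.single i y with hL
  set b := hedgedBias P L s.2.1 r i with hb
  set s' := topStep P s i x with hs'
  have hz' : s'.1 - s'.2.1 = z + Pi.single i (y - b) := stateProb_topStep P s i x
  have hr' : s'.2.2 = r := rfl
  have hB' : s'.2.1 = s.2.1 + Pi.single i b := rfl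
  set q' := stateProb P s' with hq'
  have hq'e : q' = ftrl P.η (z + Pi.single i (y - b)) := by rw [← hz']; rfl
  have hqe : q = ftrl P.η z := rfl
  have hq'0 : ∀ j, 0 < q' j := stateProb_pos P s'
  have hc : ∀ j, initialBias P j + s.2.1 j = √((r j)⁻¹) * P.R j := fun j => (hs j).2
  have htarget : hedgedTarget P L s.2.1 r i b = √((min (r i) (q' i))⁻¹) * P.R i := by
    have : L - s.2.1 - Pi.single i b = z + Pi.single i (y - b) := by
      rw [hL, hz, Pi.single_sub]
      abel
    rw [hedgedTarget, this, hq'e]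
  -- The bias exists because the invariant puts the old cumulative bias at `√(1/r) R`, and the
  -- target at zero bias takes a further minimum inside the inverse.
  obtain ⟨hb0, hb1⟩ := hedgedBias_spec P L s.2.1 r i (by
    rw [hc i, hedgedTarget]
    exact mul_le_mul_of_nonneg_right (Real.sqrt_le_sqrt (inv_anti₀
      (lt_min (hr0 i) (ftrl_pos P.η_pos _ _)) (min_le_left _ _))) (P.R_nonneg i))
  rw [← hb] at hb0 hb1
  rw [htarget, hc i] at hb1
  -- If the new probability is not below the running minimum, the target is unchanged and the bias
  -- must vanish.
  have hlt : 0 < b → q' i < r i := by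
    intro hbpos
    by_contra! hle
    rw [min_eq_left hle] at hb1
    linarith
  -- A bias larger than `y` would lower the net loss of `i`, hence raise its probability above the
  -- running minimum, contradicting `hlt`.
  have hby : b ≤ y := by
    by_contra! hyb
    have h1 := hlt (hy0.trans_lt hyb)
    have h2 := ftrl_mono P.η z i (sub_nonneg.2 hyb.le)
    have h3 : z - Pi.single i (b - y) = z + Pi.single i (y - b) := by
      rw [← neg_sub y b, Pi.single_neg, sub_neg_eq_add]
    rw [h3, ← hq'e, ← hqe] at h2
    have h4 : r i ≤ q i := min_le_right _ _
    linarith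
  -- The net loss `y - b` is nonnegative, so all other probabilities grow. Their `ρ` is unchanged,
  -- and their hedging identity survives without any bias.
  have hother : ∀ j, j ≠ i → min (r j) (q' j) = r j := by
    intro j hj
    have := ftrl_mono_other P.η_pos z hj (sub_nonneg.2 hby)
    rw [← hq'e, ← hqe] at this
    exact min_eq_left ((min_le_right _ _).trans this)
  refine ⟨fun m => ⟨hr0 m, ?_⟩, ?_⟩
  · rw [hr', hB', Pi.add_apply]
    by_cases hm : m = i
    · rw [hm, Pi.single_eq_same, ← add_assoc, hc i, hb1]
    · rw [Pi.single_eq_of_ne hm, add_zero, hc m, hother m hm]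
  · have hpot : biasPotential P s - biasPotential P s' =
        √(r i) * P.R i - √(min (r i) (q' i)) * P.R i := by
      rw [biasPotential, biasPotential, ← Finset.sum_sub_distrib]
      refine Finset.sum_eq_single_of_mem i (Finset.mem_univ i) fun j _ hj => ?_
      have := hother j hj
      rw [hr', this]
      exact sub_self _
    have hbias : b * q' i ≤ biasPotential P s - biasPotential P s' := by
      have hmin0 : 0 < min (r i) (q' i) := lt_min (hr0 i) (hq'0 i)
      have h1 := sqrt_inv_gap (P.R_nonneg i) hmin0 (hr0 i)
      rw [← hb1, add_sub_cancel_left, ← hpot] at h1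
      rcases hb0.eq_or_lt with h0 | h0
      · rw [← h0, zero_mul] at h1 ⊢
        exact h1
      · rwa [min_eq_right (hlt h0).le] at h1
    have hconc : ftrlValue P.η (z + Pi.single i y) ≤ stateValue P s' + q' i * b := by
      have := ftrlValue_add_single_le P.η (z + Pi.single i (y - b)) i b
      rwa [add_assoc, ← Pi.single_add, sub_add_cancel, ← hq'e, ← hz'] at this
    have hstab := ftrl_stability P.η_pos z i hy0
    rw [← hqe] at hstab
    have e1 : q i * y = x := mul_div_cancel₀ _ (hq0 i).ne'
    have e2 : P.η * (q i * √(q i)) * y ^ 2 = P.η * x ^ 2 / √(q i) := by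
      have h0 := Real.sqrt_pos.2 (hq0 i)
      have h1 : q i = √(q i) ^ 2 := (Real.sq_sqrt (hq0 i).le).symm
      rw [hy]
      generalize √(q i) = u at *
      rw [h1]
      field_simp
    have e3 : stateValue P s = ftrlValue P.η z := rfl
    rw [e1, e2] at hstab
    linarith [mul_comm b (q' i)]

variable {X : Type*} {K : ℕ}

theorem initialBias_eq (P : HedgedParams M) {m : Fin M} (hβ : P.β m ≤ 1 / M) :
    initialBias P m = √((P.β m)⁻¹) * P.R m := by
  rw [initialBias, ftrl_zero P.η_pos, min_eq_left hβ]

theorem Round.loss_nonneg {M : ℕ} (ω : Round X K M) (a : Fin K) : 0 ≤ ω.loss a := (ω.1.1.2 a).2.1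

theorem Round.loss_le_one {M : ℕ} (ω : Round X K M) (a : Fin K) : ω.loss a ≤ 1 := (ω.1.1.2 a).2.2

/-- The regret of the hedged top algorithm in terms of the observed losses, along every history. -/
theorem topState_bound (P : HedgedParams M) (hβ : ∀ m, 0 < P.β m) (n : ℕ)
    (h : Fin n → Round X K M) :
    IsHedged P (topState P n h) ∧
      ∑ t, (h t).loss (h t).arm ≤
        stateValue P (topState P n h) - ftrlValue P.η (0 : Fin M → ℝ) +
        (∑ m, √(P.β m) * P.R m - biasPotential P (topState P n h)) +
        ∑ t : Fin n, P.η / √(topProb P t (before h t) (h t).base) := by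
  induction n with
  | zero =>
    refine ⟨fun m => ⟨hβ m, ?_⟩, ?_⟩
    · simp [topState, initialBias, stateProb]
    -- Only an inequality, since `β m` is not assumed to be at most `q_{1,m}` here.
    · have : biasPotential P (topState P 0 h) ≤ ∑ m, √(P.β m) * P.R m :=
        Finset.sum_le_sum fun m _ => mul_le_mul_of_nonneg_right
          (Real.sqrt_le_sqrt (min_le_left _ _)) (P.R_nonneg m)
      simp only [Finset.univ_eq_empty, Finset.sum_empty, stateValue]
      simp only [topState, sub_self] at this ⊢
      linarith
  | succ n ih =>
    obtain ⟨ih1, ih2⟩ := ih fun i => h i.castSucc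
    set ω := h (Fin.last n) with hω
    have hx0 : 0 ≤ ω.loss ω.arm := ω.loss_nonneg _
    obtain ⟨h1, h2⟩ := topStep_spec P ih1 ω.base hx0
    refine ⟨h1, ?_⟩
    have h3 : P.η * ω.loss ω.arm ^ 2 / √(stateProb P (topState P n fun i => h i.castSucc) ω.base) ≤
        P.η / √(stateProb P (topState P n fun i => h i.castSucc) ω.base) := by
      refine div_le_div_of_nonneg_right ?_ (Real.sqrt_nonneg _)
      have := pow_le_one₀ (n := 2) hx0 (ω.loss_le_one _)
      nlinarith [P.η_pos]
    rw [Fin.sum_univ_castSucc, Fin.sum_univ_castSucc]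
    have e1 : topState P (n + 1) h =
      topStep P (topState P n fun i => h i.castSucc) ω.base (ω.loss ω.arm) := rfl
    have e2 : topProb P (Fin.last n) (before h (Fin.last n)) (h (Fin.last n)).base =
      stateProb P (topState P n fun i => h i.castSucc) ω.base := rfl
    have e3 : ∀ t : Fin n, topProb P t.castSucc (before h t.castSucc) (h t.castSucc).base =
      topProb P t (before (fun i => h i.castSucc) t) (h t.castSucc).base := fun t => rfl
    rw [e1, e2]
    simp only [e3]
    linarith

/-- The cumulative importance-weighted loss. -/
theorem topState_loss (P : HedgedParams M) (n : ℕ) (h : Fin n → Round X K M) (m : Fin M) :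
    (topState P n h).1 m = ∑ t, if (h t).base = m then
      (h t).loss (h t).arm / topProb P t (before h t) m else 0 := by
  induction n with
  | zero => simp [topState]
  | succ n ih =>
    rw [Fin.sum_univ_castSucc]
    have e3 : ∀ t : Fin n, topProb P t.castSucc (before h t.castSucc) m =
      topProb P t (before (fun i => h i.castSucc) t) m := fun t => rfl
    simp only [e3]
    rw [← ih fun i => h i.castSucc]
    have e1 : (topState P (n + 1) h).1 m = (topState P n fun i => h i.castSucc).1 m +
      (Pi.single (h (Fin.last n)).base ((h (Fin.last n)).loss (h (Fin.last n)).arm /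
        topProb P n (before h (Fin.last n)) (h (Fin.last n)).base) : Fin M → ℝ) m := rfl
    rw [e1, Pi.single_apply]
    congr 1
    by_cases hm : m = (h (Fin.last n)).base
    · subst hm
      simp
    · rw [if_neg hm, if_neg (Ne.symm hm)]

/-- The regret of the hedged top algorithm against a base algorithm on importance-weighted losses:
the hedging term `√ρ R` compensates for the regret of the base algorithm. -/
theorem hedged_regret_bound (P : HedgedParams M) (hβ : ∀ m, 0 < P.β m)
    (hβ' : ∀ m, P.β m ≤ 1 / M) (n : ℕ) (h : Fin n → Round X K M) (m : Fin M) :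
    ∑ t, (h t).loss (h t).arm + sqrtRho P n h m * P.R m ≤
      (∑ t, if (h t).base = m then (h t).loss (h t).arm / topProb P t (before h t) m else 0) +
      √((P.β m)⁻¹) * P.R m + ∑ i, √(P.β i) * P.R i + 2 * √M / P.η +
        ∑ t : Fin n, P.η / √(topProb P t (before h t) (h t).base) := by
  obtain ⟨h1, h2⟩ := topState_bound P hβ n h
  rw [← topState_loss]
  set s := topState P n h with hs
  have h3 : stateValue P s ≤ s.1 m - s.2.1 m := ftrlValue_le P.η_pos _ m
  have h4 := ftrlValue_zero_ge (M := M) P.η_pos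
  have h5 := (h1 m).2
  rw [initialBias_eq P (hβ' m)] at h5
  -- The invariant yields `ρ` at index `n + 1`, whereas the stability hypothesis needs index `n`.
  -- Monotonicity of `ρ` goes the right way.
  have h6 : sqrtRho P n h m * P.R m ≤ √((min (s.2.2 m) (stateProb P s m))⁻¹) * P.R m :=
    mul_le_mul_of_nonneg_right (Real.sqrt_le_sqrt (inv_anti₀
      (lt_min (h1 m).1 (stateProb_pos P s m)) (min_le_left _ _))) (P.R_nonneg m)
  have h7 : 0 ≤ biasPotential P s :=
    Finset.sum_nonneg fun m _ => mul_nonneg (Real.sqrt_nonneg _) (P.R_nonneg m)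
  linarith

end

/-! ### Expectations under the law of the interaction -/

variable {M : ℕ} [NeZero M] {X : Type*} [MeasurableSpace X] {K : ℕ}

/-- Expectations of sums over the rounds reduce to the conditional laws of the rounds. -/
theorem integral_sum_law (P : HedgedParams M) (𝓑 : Fin M → BaseAlgorithm X K)
    (E : Environment X K M) (g : (n : ℕ) → (Fin n → Round X K M) × Round X K M → ℝ)
    (hg : ∀ n, Integrable (g n) (law P 𝓑 E n ⊗ₘ roundKernel P 𝓑 E n)) (n : ℕ) :
    Integrable (fun h => ∑ t : Fin n, g t (before h t, h t)) (law P 𝓑 E n) ∧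
      ∫ h, ∑ t : Fin n, g t (before h t, h t) ∂(law P 𝓑 E n) =
        ∑ t : Fin n, ∫ p, g t p ∂(law P 𝓑 E t ⊗ₘ roundKernel P 𝓑 E t) := by
  induction n with
  | zero => simp
  | succ n ih =>
    set μ := law P 𝓑 E n ⊗ₘ roundKernel P 𝓑 E n with hμ
    have hlaw : law P 𝓑 E (n + 1) = μ.map
      fun p => (Fin.snoc p.1 p.2 : Fin (n + 1) → Round X K M) := rfl
    set f : (Fin (n + 1) → Round X K M) → ℝ :=
      fun h => ∑ t : Fin (n + 1), g t (before h t, h t) with hf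
    have hfst : μ.map Prod.fst = law P 𝓑 E n := Measure.fst_compProd _ _
    have hS : Integrable (fun p : (Fin n → Round X K M) × Round X K M =>
        ∑ t : Fin n, g t (before p.1 t, p.1 t)) μ := by
      have := ih.1
      rw [← hfst] at this
      exact this.comp_measurable measurable_fst
    have hSint : ∫ p, ∑ t : Fin n, g t (before p.1 t, p.1 t) ∂μ =
        ∑ t : Fin n, ∫ p, g t p ∂(law P 𝓑 E t ⊗ₘ roundKernel P 𝓑 E t) := by
      rw [← ih.2, ← hfst, integral_map measurable_fst.aemeasurable]
      rw [hfst]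
      exact ih.1.1
    have hcomp : (f ∘ fun p : (Fin n → Round X K M) × Round X K M =>
        (Fin.snoc p.1 p.2 : Fin (n + 1) → Round X K M)) =
        fun p => ∑ t : Fin n, g t (before p.1 t, p.1 t) + g n p := by
      funext p
      simp only [Function.comp_apply, hf, Fin.sum_univ_castSucc]
      have h1 : ∀ t : Fin n, before (Fin.snoc p.1 p.2 : Fin (n + 1) → Round X K M) t.castSucc =
          before p.1 t := fun t => funext fun i => by
        exact Fin.snoc_castSucc (α := fun _ => Round X K M) p.2 p.1 (Fin.castLE t.isLt.le i)
      have h2 : before (Fin.snoc p.1 p.2 : Fin (n + 1) → Round X K M) (Fin.last n) = p.1 :=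
        funext fun i => Fin.snoc_castSucc (α := fun _ => Round X K M) p.2 p.1 i
      simp only [Fin.snoc_castSucc, Fin.snoc_last, Fin.val_castSucc]
      congr 1
      · exact Finset.sum_congr rfl fun t _ => by
          exact congrArg (fun b => g t (b, p.1 t)) (h1 t)
      · exact congrArg (fun b => g n (b, p.2)) h2
    -- As an embedding, `Fin.snoc` transfers integrals without a separate measurability proof for
    -- `f`.
    have he : MeasurableEmbedding fun p : (Fin n → Round X K M) × Round X K M =>
        (Fin.snoc p.1 p.2 : Fin (n + 1) → Round X K M) := by
      let e : (Fin n → Round X K M) × Round X K M ≃ᵐ (Fin (n + 1) → Round X K M) :=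
        { toFun := fun p => Fin.snoc p.1 p.2
          invFun := fun h => (fun i => h i.castSucc, h (Fin.last n))
          left_inv := fun p => by simp
          right_inv := fun h => by
            funext i
            induction i using Fin.lastCases with
            | last => simp
            | cast i => simp
          measurable_toFun := measurable_snoc n
          measurable_invFun := by
            change Measurable fun h : Fin (n + 1) → Round X K M =>
              ((fun i : Fin n => h i.castSucc), h (Fin.last n))
            fun_prop }
      exact e.measurableEmbedding
    rw [hlaw, he.integrable_map_iff, he.integral_map]
    have hcomp' : ∀ p : (Fin n → Round X K M) × Round X K M,
        f (Fin.snoc p.1 p.2 : Fin (n + 1) → Round X K M) =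
        ∑ t : Fin n, g t (before p.1 t, p.1 t) + g n p := fun p => congrFun hcomp p
    refine ⟨by rw [hcomp]; exact hS.add (hg n), ?_⟩
    refine (integral_congr_ae (Filter.Eventually.of_forall hcomp')).trans ?_
    rw [integral_add hS (hg n), hSint, Fin.sum_univ_castSucc]
    rfl

theorem integral_topKernel (P : HedgedParams M) (n : ℕ) (h : Fin n → Round X K M)
    (w : Fin M → ℝ) :
    ∫ m, w m ∂(topKernel P n h) = ∑ m, topProb P n h m * w m := by
  have e : topKernel P n h = ∑ m, ENNReal.ofReal (topProb P n h m) • Measure.dirac m := rfl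
  rw [e, integral_finsetSum_measure fun m _ =>
    (Integrable.of_finite (μ := Measure.dirac m)).smul_measure ENNReal.ofReal_ne_top]
  refine Finset.sum_congr rfl fun m _ => ?_
  have hq : 0 < topProb P n h m := stateProb_pos P _ m
  rw [integral_smul_measure, integral_dirac, ENNReal.toReal_ofReal hq.le, smul_eq_mul]

/-- Given the past, the environment and the selected base algorithm are independent. -/
theorem integral_roundKernel (P : HedgedParams M) (𝓑 : Fin M → BaseAlgorithm X K)
    (E : Environment X K M) (n : ℕ) (h : Fin n → Round X K M)
    {u : X × (Fin K → Set.Icc (0 : ℝ) 1) → ℝ} (hu : Measurable u) (w : Fin M → ℝ) :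
    ∫ ω, u ω.1.1 * w ω.base ∂(roundKernel P 𝓑 E n h) =
      (∫ y, u y ∂(E.next n h)) * ∑ m, topProb P n h m * w m := by
  -- The integrand does not see the arm, and without the arm the round has a product law.
  have hfst : (roundKernel P 𝓑 E n h).map Prod.fst = (E.next n h).prod (topKernel P n h) := by
    have : (roundKernel P 𝓑 E n).fst = E.next n ×ₖ topKernel P n := Kernel.fst_compProd _ _
    rw [← Kernel.prod_apply, ← this, Kernel.fst_apply]
  rw [← integral_topKernel, ← integral_prod_mul, ← hfst, integral_map measurable_fst.aemeasurable]
  · rfl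
  · exact ((hu.comp measurable_fst).mul
      ((measurable_of_finite w).comp measurable_snd)).aestronglyMeasurable

theorem measurable_base {M : ℕ} : Measurable (Round.base : Round X K M → Fin M) :=
  measurable_snd.comp measurable_fst

/-- A function of the environment's move that is bounded by `1`, reweighted according to the
selected base algorithm. -/
theorem integral_reweighted (P : HedgedParams M) (𝓑 : Fin M → BaseAlgorithm X K)
    (E : Environment X K M) (n : ℕ) {u : X × (Fin K → Set.Icc (0 : ℝ) 1) → ℝ}
    (hu : Measurable u) (hu0 : ∀ y, 0 ≤ u y) (hu1 : ∀ y, u y ≤ 1)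
    {w : (Fin n → Round X K M) → Fin M → ℝ} (hw : Measurable fun p : _ × _ => w p.1 p.2)
    (hw0 : ∀ h m, 0 ≤ w h m) {c : ℝ} (hwc : ∀ h, ∑ m, topProb P n h m * w h m ≤ c) :
    Integrable (fun p : (Fin n → Round X K M) × Round X K M => u p.2.1.1 * w p.1 p.2.base)
        (law P 𝓑 E n ⊗ₘ roundKernel P 𝓑 E n) ∧
      ∫ p, u p.2.1.1 * w p.1 p.2.base ∂(law P 𝓑 E n ⊗ₘ roundKernel P 𝓑 E n) =
        ∫ h, (∫ y, u y ∂(E.next n h)) * ∑ m, topProb P n h m * w h m ∂(law P 𝓑 E n) := by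
  have hm : Measurable fun p : (Fin n → Round X K M) × Round X K M =>
      u p.2.1.1 * w p.1 p.2.base :=
    (hu.comp (measurable_fst.comp (measurable_fst.comp measurable_snd))).mul
      (hw.comp (measurable_fst.prodMk (measurable_base.comp measurable_snd)))
  have hint : Integrable (fun p : (Fin n → Round X K M) × Round X K M =>
      u p.2.1.1 * w p.1 p.2.base) (law P 𝓑 E n ⊗ₘ roundKernel P 𝓑 E n) := by
    rw [Measure.integrable_compProd_iff hm.aestronglyMeasurable]
    refine ⟨Filter.Eventually.of_forall fun h => ?_, ?_⟩
    -- The weights need not be bounded uniformly in the history, so this bound depends on `h`.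
    -- Integrability over the histories comes from the conditional mean, which is at most `c`.
    · refine Integrable.of_bound (hm.comp measurable_prodMk_left).aestronglyMeasurable
        (∑ m, w h m) (Filter.Eventually.of_forall fun ω => ?_)
      simp only [Real.norm_eq_abs]
      rw [abs_of_nonneg (mul_nonneg (hu0 _) (hw0 _ _))]
      exact (mul_le_of_le_one_left (hw0 _ _) (hu1 _)).trans
        (Finset.single_le_sum (f := w h) (fun m _ => hw0 h m) (Finset.mem_univ _))
    · refine Integrable.of_bound (C := c) ?_ (Filter.Eventually.of_forall fun h => ?_)
      · exact (hm.norm.stronglyMeasurable.integral_kernel_prod_right'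
          (κ := roundKernel P 𝓑 E n)).aestronglyMeasurable
      · have e : ∀ ω : Round X K M, ‖u ω.1.1 * w h ω.base‖ = u ω.1.1 * w h ω.base := fun ω =>
          Real.norm_of_nonneg (mul_nonneg (hu0 _) (hw0 _ _))
        have hp := fun m => (ftrl_mem (M := M) P.η
          ((topState P n h).1 - (topState P n h).2.1)).1 m
        have hq0 : 0 ≤ ∑ m, topProb P n h m * w h m :=
          Finset.sum_nonneg fun m _ => mul_nonneg (hp m) (hw0 h m)
        have hi0 : 0 ≤ ∫ y, u y ∂(E.next n h) := integral_nonneg hu0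
        have hi1 : ∫ y, u y ∂(E.next n h) ≤ 1 := by
          have := integral_mono_of_nonneg (μ := E.next n h) (Filter.Eventually.of_forall hu0)
            (integrable_const (1 : ℝ)) (Filter.Eventually.of_forall hu1)
          simpa using this
        simp only [e]
        rw [integral_roundKernel P 𝓑 E n h hu, Real.norm_of_nonneg (mul_nonneg hi0 hq0)]
        exact (mul_le_of_le_one_left hq0 hi1).trans (hwc h)
  refine ⟨hint, ?_⟩
  rw [Measure.integral_compProd hint]
  exact integral_congr_ae (Filter.Eventually.of_forall fun h =>
    integral_roundKernel P 𝓑 E n h hu (w h))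

/-- The importance-weighted estimate of a function of the environment's move is unbiased. -/
theorem integral_importanceWeighted (P : HedgedParams M) (𝓑 : Fin M → BaseAlgorithm X K)
    (E : Environment X K M) (n : ℕ) (m : Fin M) {u : X × (Fin K → Set.Icc (0 : ℝ) 1) → ℝ}
    (hu : Measurable u) (hu0 : ∀ y, 0 ≤ u y) (hu1 : ∀ y, u y ≤ 1) :
    Integrable (fun p : (Fin n → Round X K M) × Round X K M =>
        if p.2.base = m then u p.2.1.1 / topProb P n p.1 m else 0)
        (law P 𝓑 E n ⊗ₘ roundKernel P 𝓑 E n) ∧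
      Integrable (fun p : (Fin n → Round X K M) × Round X K M => u p.2.1.1)
        (law P 𝓑 E n ⊗ₘ roundKernel P 𝓑 E n) ∧
      ∫ p, (if p.2.base = m then u p.2.1.1 / topProb P n p.1 m else 0)
        ∂(law P 𝓑 E n ⊗ₘ roundKernel P 𝓑 E n) =
        ∫ p, u p.2.1.1 ∂(law P 𝓑 E n ⊗ₘ roundKernel P 𝓑 E n) := by
  have hq0 : ∀ h : Fin n → Round X K M, ∀ i, 0 < topProb P n h i := fun h i => stateProb_pos P _ i
  have hq1 : ∀ h : Fin n → Round X K M, ∑ i, topProb P n h i = 1 := fun h => (ftrl_mem _ _).2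
  -- The importance weight and the constant weight `1` have the same conditional mean, so both
  -- expectations reduce to the same integral.
  have hs1 : ∀ h : Fin n → Round X K M,
      ∑ i, topProb P n h i * (if i = m then 1 / topProb P n h m else 0) = 1 := by
    intro h
    simp [(hq0 h m).ne']
  have hs2 : ∀ h : Fin n → Round X K M, ∑ i, topProb P n h i * 1 = 1 := by
    simpa using hq1
  obtain ⟨h1, h2⟩ := integral_reweighted P 𝓑 E n hu hu0 hu1
    (w := fun h i => if i = m then 1 / topProb P n h m else 0)
    (by
      refine Measurable.ite (measurable_snd (measurableSet_singleton m)) ?_ measurable_const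
      exact measurable_const.div
        ((measurable_pi_apply m).comp ((measurable_topProb P n).comp measurable_fst)))
    (fun h i => by
      have := (hq0 h m).le
      split_ifs <;> positivity)
    (c := 1) (fun h => (hs1 h).le)
  obtain ⟨h3, h4⟩ := integral_reweighted P 𝓑 E n hu hu0 hu1 (w := fun _ _ => 1)
    measurable_const (fun _ _ => zero_le_one) (c := 1) (fun h => (hs2 h).le)
  simp only [mul_one] at h3
  simp only [hs1] at h2
  simp only [hs2] at h4
  have e : ∀ p : (Fin n → Round X K M) × Round X K M,
      u p.2.1.1 * (if p.2.base = m then 1 / topProb P n p.1 m else 0) =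
      if p.2.base = m then u p.2.1.1 / topProb P n p.1 m else 0 := fun p => by
    split_ifs <;> ring
  simp only [e] at h1 h2
  refine ⟨h1, h3, h2.trans (h4.symm.trans ?_)⟩
  simp only [mul_one]

/-- Averaging over the selected base turns `η / √q` into `η ∑ √q`, which Cauchy-Schwarz bounds. -/
theorem integral_inv_sqrt_prob (P : HedgedParams M) (𝓑 : Fin M → BaseAlgorithm X K)
    (E : Environment X K M) (n : ℕ) :
    Integrable (fun p : (Fin n → Round X K M) × Round X K M =>
        P.η / √(topProb P n p.1 p.2.base)) (law P 𝓑 E n ⊗ₘ roundKernel P 𝓑 E n) ∧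
      ∫ p, P.η / √(topProb P n p.1 p.2.base) ∂(law P 𝓑 E n ⊗ₘ roundKernel P 𝓑 E n) ≤
        P.η * √M := by
  have hq0 : ∀ h : Fin n → Round X K M, ∀ i, 0 < topProb P n h i := fun h i => stateProb_pos P _ i
  have hs : ∀ h : Fin n → Round X K M,
      ∑ i, topProb P n h i * (P.η / √(topProb P n h i)) ≤ P.η * √M := by
    intro h
    have e : ∀ i, topProb P n h i * (P.η / √(topProb P n h i)) = P.η * √(topProb P n h i) := by
      intro i
      have h1 := Real.mul_self_sqrt (hq0 h i).le
      have h2 := Real.sqrt_pos.2 (hq0 h i)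
      field_simp
      rw [sq, h1, mul_comm]
    simp only [e, ← Finset.mul_sum]
    exact mul_le_mul_of_nonneg_left (sum_sqrt_le (ftrl_mem _ _)) P.η_pos.le
  obtain ⟨h1, h2⟩ := integral_reweighted P 𝓑 E n (u := fun _ => 1) measurable_const
    (fun _ => zero_le_one) (fun _ => le_rfl) (w := fun h i => P.η / √(topProb P n h i))
    (by
      refine measurable_from_prod_countable_left fun m => ?_
      exact measurable_const.div
        (((measurable_pi_apply m).comp (measurable_topProb P n)).sqrt))
    (fun h i => div_nonneg P.η_pos.le (Real.sqrt_nonneg _)) hs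
  simp only [one_mul] at h1 h2
  refine ⟨h1, h2.trans_le ?_⟩
  have hn := (E.markov n)
  simp only [integral_const, probReal_univ, smul_eq_mul, one_mul]
  have := integral_mono_of_nonneg (μ := law P 𝓑 E n) (Filter.Eventually.of_forall fun h =>
    Finset.sum_nonneg fun i _ => mul_nonneg (hq0 h i).le
      (div_nonneg P.η_pos.le (Real.sqrt_nonneg (topProb P n h i))))
    (integrable_const (P.η * √M)) (Filter.Eventually.of_forall hs)
  simpa using this

theorem integrable_observedLoss (P : HedgedParams M) (𝓑 : Fin M → BaseAlgorithm X K)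
    (E : Environment X K M) (n : ℕ) :
    Integrable (fun p : (Fin n → Round X K M) × Round X K M => p.2.loss p.2.arm)
      (law P 𝓑 E n ⊗ₘ roundKernel P 𝓑 E n) := by
  refine Integrable.of_bound (measurable_observedLoss.comp measurable_snd).aestronglyMeasurable 1
    (Filter.Eventually.of_forall fun p => ?_)
  rw [Real.norm_of_nonneg (p.2.loss_nonneg _)]
  exact p.2.loss_le_one _

/-- Dominated by the importance-weighted constant `1`. The arm depends on the selected base, so
unbiasedness is not claimed here, nor is it needed. -/
theorem integrable_importanceWeighted_observedLoss (P : HedgedParams M)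
    (𝓑 : Fin M → BaseAlgorithm X K) (E : Environment X K M) (n : ℕ) (m : Fin M) :
    Integrable (fun p : (Fin n → Round X K M) × Round X K M =>
      if p.2.base = m then p.2.loss p.2.arm / topProb P n p.1 m else 0)
      (law P 𝓑 E n ⊗ₘ roundKernel P 𝓑 E n) := by
  refine (integral_importanceWeighted P 𝓑 E n m (u := fun _ => 1) measurable_const
    (fun _ => zero_le_one) (fun _ => le_rfl)).1.mono' ?_ (Filter.Eventually.of_forall fun p => ?_)
  · refine (Measurable.ite (measurable_base.comp measurable_snd (measurableSet_singleton m)) ?_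
      measurable_const).aestronglyMeasurable
    exact (measurable_observedLoss.comp measurable_snd).div
      ((measurable_pi_apply m).comp ((measurable_topProb P n).comp measurable_fst))
  · have hq : 0 < topProb P n p.1 m := stateProb_pos P _ m
    split_ifs
    · rw [Real.norm_of_nonneg (div_nonneg (p.2.loss_nonneg _) hq.le)]
      exact div_le_div_of_nonneg_right (p.2.loss_le_one _) hq.le
    · simp

theorem measurable_policyLoss {K : ℕ} {π : X → Fin K} (hπ : Measurable π) :
    Measurable fun y : X × (Fin K → Set.Icc (0 : ℝ) 1) => (y.2 (π y.1) : ℝ) := by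
  have h : Measurable fun p : (Fin K → Set.Icc (0 : ℝ) 1) × Fin K => (p.1 p.2 : ℝ) :=
    measurable_from_prod_countable_left fun a =>
      measurable_subtype_coe.comp (measurable_pi_apply a)
  exact h.comp (measurable_snd.prodMk (hπ.comp measurable_fst))

/-! ### Cancellation of the base regret and choice of parameters -/

/-- The expectation of a pathwise regret bound with a hedging term `H`. -/
theorem integral_le_of_hedged {Ω : Type*} [MeasurableSpace Ω] {μ : Measure Ω}
    [IsProbabilityMeasure μ] {A L Q W S H : Ω → ℝ} {c s : ℝ} (hA : Integrable A μ)
    (hL : Integrable L μ) (hQ : Integrable Q μ) (hW : Integrable W μ) (hS : Integrable S μ)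
    (hH : Measurable H) (hH0 : ∀ ω, 0 ≤ H ω) (hpath : ∀ ω, A ω + H ω ≤ L ω + c + S ω)
    (hWQ : ∫ ω, W ω ∂μ = ∫ ω, Q ω ∂μ) (hs : ∫ ω, S ω ∂μ ≤ s)
    (hstable : ∫ ω, (L ω - W ω) ∂μ ≤ ∫ ω, H ω ∂μ) :
    ∫ ω, (A ω - Q ω) ∂μ ≤ c + s := by
  have hLc : Integrable (fun ω => L ω + c) μ := hL.add (integrable_const c)
  have hLcS : Integrable (fun ω => L ω + c + S ω) μ := hLc.add hS
  -- The pathwise bound itself dominates `H`. Without integrability, its integral in `hstable` would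
  -- be the default value `0`.
  have hiH : Integrable H μ := by
    refine (hLcS.sub hA).mono' hH.aestronglyMeasurable (Filter.Eventually.of_forall fun ω => ?_)
    rw [Real.norm_of_nonneg (hH0 ω), Pi.sub_apply]
    linarith [hpath ω]
  have h1 : ∫ ω, (A ω + H ω) ∂μ ≤ ∫ ω, (L ω + c + S ω) ∂μ := integral_mono (hA.add hiH) hLcS hpath
  rw [integral_add hA hiH, integral_add hLc hS, integral_add hL (integrable_const c),
    integral_const, probReal_univ, one_smul] at h1
  rw [integral_sub hL hW] at hstable
  rw [integral_sub hA hQ]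
  linarith

theorem measurable_sqrtRho (P : HedgedParams M) (n : ℕ) (m : Fin M) :
    Measurable fun h : Fin n → Round X K M => sqrtRho P n h m := by
  have h : Measurable fun s : TopState M => √((s.2.2 m)⁻¹) := by fun_prop
  exact h.comp (measurable_topState P n)

theorem integral_le_importanceWeightedRegret (P : HedgedParams M) (𝓑 : Fin M → BaseAlgorithm X K)
    (E : Environment X K M) (T : ℕ) {m : Fin M} {π : X → Fin K} (hπ : π ∈ (𝓑 m).policies) :
    ∫ h, ∑ t, (if (h t).base = m then
      ((h t).loss (h t).arm - (h t).loss (π (h t).context)) / topProb P t (before h t) m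
      else 0) ∂(law P 𝓑 E T) ≤ importanceWeightedRegret P 𝓑 E T m := by
  unfold importanceWeightedRegret
  exact Finset.le_sup' (fun π => ∫ h, ∑ t, (if (h t).base = m then
    ((h t).loss (h t).arm - (h t).loss (π (h t).context)) / topProb P t (before h t) m
    else 0) ∂(law P 𝓑 E T)) hπ

/-- The regret of hedged Tsallis-INF on base algorithms that are stable with exponent `1/2`. -/
theorem regret_le_of_stable (P : HedgedParams M) (𝓑 : Fin M → BaseAlgorithm X K)
    (E : Environment X K M) (T : ℕ) (hβ : ∀ m, 0 < P.β m) (hβ' : ∀ m, P.β m ≤ 1 / M) (m : Fin M)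
    (hstable : importanceWeightedRegret P 𝓑 E T m ≤
      (∫ h, sqrtRho P T h m ∂(law P 𝓑 E T)) * P.R m) :
    regret P 𝓑 E T m ≤ √((P.β m)⁻¹) * P.R m + ∑ i, √(P.β i) * P.R i + 2 * √M / P.η +
      T * (P.η * √M) := by
  refine Finset.sup'_le _ _ fun π hπ => ?_
  have hIW := fun n => integral_importanceWeighted P 𝓑 E n m
    (measurable_policyLoss ((𝓑 m).measurable_policies π hπ))
    (fun y => (y.2 (π y.1)).2.1) (fun y => (y.2 (π y.1)).2.2)
  obtain ⟨iA, -⟩ := integral_sum_law P 𝓑 E (fun _ p => p.2.loss p.2.arm)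
    (integrable_observedLoss P 𝓑 E) T
  obtain ⟨iL, -⟩ := integral_sum_law P 𝓑 E
    (fun n p => if p.2.base = m then p.2.loss p.2.arm / topProb P n p.1 m else 0)
    (fun n => integrable_importanceWeighted_observedLoss P 𝓑 E n m) T
  obtain ⟨iQ, eQ⟩ := integral_sum_law P 𝓑 E (fun _ p => p.2.loss (π p.2.context))
    (fun n => (hIW n).2.1) T
  obtain ⟨iW, eW⟩ := integral_sum_law P 𝓑 E
    (fun n p => if p.2.base = m then p.2.loss (π p.2.context) / topProb P n p.1 m else 0)
    (fun n => (hIW n).1) T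
  obtain ⟨iS, eS⟩ := integral_sum_law P 𝓑 E (fun n p => P.η / √(topProb P n p.1 p.2.base))
    (fun n => (integral_inv_sqrt_prob P 𝓑 E n).1) T
  have hWQ := eW.trans (Eq.trans (Finset.sum_congr rfl fun (t : Fin T) _ => (hIW t).2.2) eQ.symm)
  have hS := eS.trans_le (Finset.sum_le_sum fun t _ => (integral_inv_sqrt_prob P 𝓑 E t).2)
  rw [Finset.sum_const, Finset.card_univ, Fintype.card_fin, nsmul_eq_mul] at hS
  have hst := (integral_le_importanceWeightedRegret P 𝓑 E T hπ).trans hstable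
  have hsplit : ∀ h : Fin T → Round X K M, ∑ t, (if (h t).base = m then
      ((h t).loss (h t).arm - (h t).loss (π (h t).context)) / topProb P t (before h t) m
      else 0) = (∑ t, if (h t).base = m then
        (h t).loss (h t).arm / topProb P t (before h t) m else 0) -
      ∑ t, if (h t).base = m then
        (h t).loss (π (h t).context) / topProb P t (before h t) m else 0 := by
    intro h
    rw [← Finset.sum_sub_distrib]
    refine Finset.sum_congr rfl fun t _ => ?_
    split_ifs
    · rw [sub_div]
    · rw [sub_zero]
  simp only [hsplit] at hst
  rw [← integral_mul_const] at hst
  simp only [Finset.sum_sub_distrib]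
  refine integral_le_of_hedged iA iL iQ iW iS ((measurable_sqrtRho P T m).mul_const _)
    (fun h => mul_nonneg (Real.sqrt_nonneg _) (P.R_nonneg m)) (fun h => ?_) hWQ hS hst
  have := hedged_regret_bound P hβ hβ' T h m
  linarith

end

end HedgedTsallis

theorem mainTheorem5 {X : Type*} [MeasurableSpace X] {K M : ℕ} [NeZero M]
    (T : ℕ) (hT : 0 < T)
    (𝓑 : Fin M → HedgedTsallis.BaseAlgorithm X K)
    (E : HedgedTsallis.Environment X K M)
    (𝔠 : ℝ) (h𝔠 : 0 < 𝔠) (C : Fin M → ℝ) (hC : ∀ m, 0 < C m)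
    (P : HedgedTsallis.HedgedParams M)
    (hη : P.η = √(2 / (T : ℝ)))
    (hR : ∀ m, P.R m = √(C m * T))
    (hβ : ∀ m, P.β m = 1 / (M : ℝ) * min 1 (𝔠 ^ 2 / C m))
    (hstable : ∀ m, HedgedTsallis.importanceWeightedRegret P 𝓑 E T m ≤
      (∫ h, HedgedTsallis.sqrtRho P T h m ∂(HedgedTsallis.law P 𝓑 E T)) * √(C m * T)) :
    ∀ m, HedgedTsallis.regret P 𝓑 E T m ≤
      2 * max 𝔠 (C m / 𝔠) * √(M * T) + 2 * √(2 * M * T) := by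
  intro m
  have hM : (0 : ℝ) < M := by exact_mod_cast NeZero.pos M
  have hT0 : (0 : ℝ) < T := by exact_mod_cast hT
  have hmin : ∀ i, 0 < min 1 (𝔠 ^ 2 / C i) := fun i =>
    lt_min one_pos (div_pos (pow_pos h𝔠 2) (hC i))
  have hβ0 : ∀ i, 0 < P.β i := fun i => by
    rw [hβ]
    exact mul_pos (one_div_pos.2 hM) (hmin i)
  have hβ1 : ∀ i, P.β i ≤ 1 / M := fun i => by
    rw [hβ]
    exact mul_le_of_le_one_right (one_div_pos.2 hM).le (min_le_left _ _)
  have hmain := HedgedTsallis.regret_le_of_stable P 𝓑 E T hβ0 hβ1 m (by rw [hR]; exact hstable m)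
  set D := max 𝔠 (C m / 𝔠) with hD
  have hD0 : 0 < D := h𝔠.trans_le (le_max_left _ _)
  -- Here `R² / β = M T max (C m) (C m² / 𝔠²)`, and `D ^ 2` dominates both entries of the maximum.
  have h1 : √((P.β m)⁻¹) * P.R m ≤ D * √(M * T) := by
    rw [hR, ← Real.sqrt_mul (inv_nonneg.2 (hβ0 m).le)]
    refine Real.sqrt_le_iff.2 ⟨by positivity, ?_⟩
    rw [mul_pow, Real.sq_sqrt (by positivity), inv_mul_le_iff₀ (hβ0 m), hβ]
    have h3 : C m ≤ min 1 (𝔠 ^ 2 / C m) * D ^ 2 := by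
      rcases le_total 1 (𝔠 ^ 2 / C m) with h | h
      · rw [min_eq_left h, one_mul]
        have h4 : C m ≤ 𝔠 ^ 2 := by rwa [one_le_div (hC m)] at h
        exact h4.trans (pow_le_pow_left₀ h𝔠.le (le_max_left _ _) 2)
      · rw [min_eq_right h]
        have h4 : (C m / 𝔠) ^ 2 ≤ D ^ 2 :=
          pow_le_pow_left₀ (div_pos (hC m) h𝔠).le (le_max_right _ _) 2
        have h5 : 𝔠 ^ 2 / C m * (C m / 𝔠) ^ 2 = C m := by
          have := hC m
          field_simp
        exact h5.symm.le.trans (mul_le_mul_of_nonneg_left h4 (div_pos (pow_pos h𝔠 2) (hC m)).le)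
    calc C m * T ≤ min 1 (𝔠 ^ 2 / C m) * D ^ 2 * T := mul_le_mul_of_nonneg_right h3 hT0.le
      _ = 1 / M * min 1 (𝔠 ^ 2 / C m) * (D ^ 2 * (M * T)) := by field_simp
  have h2 : ∑ i, √(P.β i) * P.R i ≤ D * √(M * T) := by
    -- The cap `𝔠 ^ 2 / C i` in `β` makes every summand at most `𝔠 √(T / M)`, whatever `C i` is.
    have h3 : ∀ i, √(P.β i) * P.R i ≤ 𝔠 * √(M * T) / M := by
      intro i
      rw [hR, ← Real.sqrt_mul (hβ0 i).le]
      refine Real.sqrt_le_iff.2 ⟨by positivity, ?_⟩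
      rw [div_pow, mul_pow, Real.sq_sqrt (by positivity), hβ]
      have h4 : min 1 (𝔠 ^ 2 / C i) * C i ≤ 𝔠 ^ 2 := by
        have := mul_le_mul_of_nonneg_right (min_le_right 1 (𝔠 ^ 2 / C i)) (hC i).le
        rwa [div_mul_cancel₀ _ (hC i).ne'] at this
      calc 1 / M * min 1 (𝔠 ^ 2 / C i) * (C i * T)
          = min 1 (𝔠 ^ 2 / C i) * C i * (T / M) := by ring
        _ ≤ 𝔠 ^ 2 * (T / M) := mul_le_mul_of_nonneg_right h4 (by positivity)
        _ = 𝔠 ^ 2 * (M * T) / M ^ 2 := by field_simp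
    calc ∑ i, √(P.β i) * P.R i ≤ ∑ _i : Fin M, 𝔠 * √(M * T) / M :=
          Finset.sum_le_sum fun i _ => h3 i
      _ = 𝔠 * √(M * T) := by
          rw [Finset.sum_const, Finset.card_univ, Fintype.card_fin, nsmul_eq_mul]
          field_simp
      _ ≤ D * √(M * T) := mul_le_mul_of_nonneg_right (le_max_left _ _) (Real.sqrt_nonneg _)
  have h2MT : √(2 * M * T) = √2 * √M * √T := by
    rw [Real.sqrt_mul (by positivity), Real.sqrt_mul (by positivity)]
  have hη' : P.η = √2 / √T := by rw [hη, Real.sqrt_div (by norm_num)]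
  have hs2 : (0 : ℝ) < √2 := by positivity
  have hsT : 0 < √(T : ℝ) := Real.sqrt_pos.2 hT0
  have e2 : √(2 : ℝ) ^ 2 = 2 := Real.sq_sqrt (by norm_num)
  have eT : √(T : ℝ) ^ 2 = T := Real.sq_sqrt hT0.le
  -- The value `η = √(2 / T)` equalizes the penalty term and the stability term.
  have h3 : 2 * √M / P.η = √(2 * M * T) := by
    rw [h2MT, hη', div_eq_iff (by positivity)]
    field_simp
    rw [e2]
  have h4 : T * (P.η * √M) = √(2 * M * T) := by
    rw [h2MT, hη']
    field_simp
    rw [eT]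
  rw [h3, h4] at hmain
  linarith
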